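/- Let $p\in\{1,2,3\}$ and let $A^{(p)}:L^2(0,2\pi)\to L^2(0,2\pi)$ (real-valued functions) be the operator $$(A^{(p)}\varphi)(x)=\frac{1}{\Gamma(p)}\int_0^x (x-t)^{p-1}\varphi(t)\,dt,\qquad x\in(0,2\pi).$$ For $n\in\mathbb{N}=\{0,1,2,\dots\}$ let $P_n$ be the orthogonal projection of $L^2(0,2\pi)$ onto $$X_n=\operatorname{span}\left\{\frac{1}{\sqrt{2\pi}},\frac{\cos t}{\sqrt\pi},\frac{\sin t}{\sqrt\pi},\dots,\frac{\cos nt}{\sqrt\pi},\frac{\sin nt}{\sqrt\pi}\right\},$$ let $A_n^{(p)}=P_nA^{(p)}P_n:X_n\to X_n$, and let $A_n^{(p)\dagger}:X_n\to X_n$ be its Moore-Penrose inverse: $A_n^{(p)\dagger}y$ is the element of smallest norm among the minimizers $x\in X_n$ of $\|A_n^{(p)}x-y\|_{L^2}$. Put $$R_n^{(p)}:=A_n^{(p)\dagger}P_nA^{(p)}:L^2(0,2\pi)\to X_n\subseteq L^2(0,2\pi).$$ Theorem 5.1. Groetsch regularity holds for the trigonometric Galerkin scheme: for $p=1,2,3$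 the operator norms $\|R_n^{(p)}\|_{L^2\to L^2}$, $n\in\mathbb N$, are bounded and $$\sup_{n}\|R_n^{(p)}\|_{L^2\to L^2}\le\gamma^{(p)}:=1+\kappa^{(p)}<\infty,\qquad \kappa^{(p)}:=\Big(\sum_{i=1}^{6}\big(C_i^{(p)}\big)^2\Big)^{1/2},$$ where $$\big(C_i^{(1)}\big)_{i=1}^6=\Big(0,0,0,\tfrac{\sqrt2}{\pi},\tfrac{2}{\pi},0\Big),\quad \big(C_i^{(2)}\big)_{i=1}^6=\Big(\sqrt2,2,\pi,\tfrac{3\sqrt2}{2},3,5\Big),\quad \big(C_i^{(3)}\big)_{i=1}^6=\Big(11\sqrt2,23,11\pi,\tfrac{44\sqrt2}{3},30,48\Big).$$ Numerically, $\kappa^{(1)}\approx0.78$, $\kappa^{(2)}\approx7.37$, $\kappa^{(3)}\approx74.82$, each with an error less than $0.01$. -/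

import Mathlib

open MeasureTheory

noncomputable section

namespace TrigGalerkin

/-! ### The Moore-Penrose inverse -/

section MoorePenrose

variable {X Y : Type*} [NormedAddCommGroup X] [InnerProductSpace ℝ X]
  [NormedAddCommGroup Y] [InnerProductSpace ℝ Y]

/-- `x` minimizes the residual `‖T x - y‖`. -/
def IsLeastSquares (T : X →L[ℝ] Y) (y : Y) (x : X) : Prop :=
  ∀ z : X, ‖T x - y‖ ≤ ‖T z - y‖

/-- `x` is the element of smallest norm among the minimizers of the residual `‖T x - y‖`. -/
def IsMinNormLeastSquares (T : X →L[ℝ] Y) (y : Y) (x : X) : Prop :=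
  IsLeastSquares T y x ∧ ∀ x' : X, IsLeastSquares T y x' → ‖x‖ ≤ ‖x'‖

variable [FiniteDimensional ℝ X]

theorem isLeastSquares_iff (T : X →L[ℝ] Y) (y : Y) (x : X) :
    IsLeastSquares T y x ↔ T x = (LinearMap.range T.toLinearMap).starProjection y := by
  set R := LinearMap.range T.toLinearMap with hR
  have hmem : ∀ z, T z ∈ R := fun z => ⟨z, rfl⟩
  have pyth : ∀ z, ‖T z - y‖ ^ 2 = ‖T z - R.starProjection y‖ ^ 2
      + ‖R.starProjection y - y‖ ^ 2 := by
    intro z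
    have h1 : T z - R.starProjection y ∈ R :=
      R.sub_mem (hmem z) (R.starProjection_apply_mem y)
    have h2 : inner ℝ (T z - R.starProjection y) (R.starProjection y - y) = 0 := by
      have := R.sub_starProjection_mem_orthogonal y
      have h3 := (Submodule.mem_orthogonal R _).1 this _ h1
      rw [← neg_sub y, inner_neg_right, h3, neg_zero]
    have h4 := norm_add_sq_real (T z - R.starProjection y) (R.starProjection y - y)
    rw [h2] at h4
    simpa using h4
  constructor
  · intro h
    obtain ⟨z, hz⟩ := R.starProjection_apply_mem y
    have hz' : T z = R.starProjection y := hz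
    have h1 := pow_le_pow_left₀ (norm_nonneg _) (h z) 2
    rw [pyth x, pyth z, hz', sub_self, norm_zero] at h1
    have h2 : ‖T x - R.starProjection y‖ ^ 2 = 0 :=
      le_antisymm (by linarith) (sq_nonneg _)
    exact sub_eq_zero.1 (norm_eq_zero.1 (pow_eq_zero_iff two_ne_zero |>.1 h2))
  · intro h z
    refine le_of_sq_le_sq ?_ (norm_nonneg _)
    rw [pyth x, pyth z, h, sub_self, norm_zero]
    nlinarith [sq_nonneg ‖T z - R.starProjection y‖]

theorem isMinNormLeastSquares_iff (T : X →L[ℝ] Y) (y : Y) (x : X) :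
    IsMinNormLeastSquares T y x ↔
      T x = (LinearMap.range T.toLinearMap).starProjection y ∧
        x ∈ (LinearMap.ker T.toLinearMap)ᗮ := by
  set K := LinearMap.ker T.toLinearMap with hK
  have hTK : ∀ v ∈ K, T v = 0 := fun v hv => hv
  unfold IsMinNormLeastSquares
  simp only [isLeastSquares_iff]
  refine and_congr_right fun hx => ?_
  constructor
  · intro h
    have h0 : T (K.starProjection x) = 0 := hTK _ (K.starProjection_apply_mem x)
    have h1 := h (x - K.starProjection x) (by rw [map_sub, h0, sub_zero, hx])
    have h2 : inner ℝ (K.starProjection x) (x - K.starProjection x) = 0 :=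
      (Submodule.mem_orthogonal K _).1 (K.sub_starProjection_mem_orthogonal x) _
        (K.starProjection_apply_mem x)
    have h3 := norm_add_sq_real (K.starProjection x) (x - K.starProjection x)
    rw [h2, add_sub_cancel] at h3
    have h4 := pow_le_pow_left₀ (norm_nonneg _) h1 2
    have h5 : ‖K.starProjection x‖ ^ 2 = 0 := le_antisymm (by linarith) (sq_nonneg _)
    have h6 : K.starProjection x = 0 :=
      norm_eq_zero.1 (pow_eq_zero_iff two_ne_zero |>.1 h5)
    have h7 := K.sub_starProjection_mem_orthogonal x
    rwa [h6, sub_zero] at h7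
  · intro h x' hx'
    have h1 : x' - x ∈ K := by
      change T (x' - x) = 0
      rw [map_sub, hx, hx', sub_self]
    have h2 : inner ℝ (x' - x) x = 0 := (Submodule.mem_orthogonal K _).1 h _ h1
    have h3 := norm_add_sq_real (x' - x) x
    rw [h2, sub_add_cancel] at h3
    refine le_of_sq_le_sq ?_ (norm_nonneg _)
    nlinarith [sq_nonneg ‖x' - x‖]

theorem existsUnique_isMinNormLeastSquares (T : X →L[ℝ] Y) (y : Y) :
    ∃! x : X, IsMinNormLeastSquares T y x := by
  simp only [isMinNormLeastSquares_iff]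
  set K := LinearMap.ker T.toLinearMap with hK
  have hTK : ∀ v ∈ K, T v = 0 := fun v hv => hv
  obtain ⟨z, hz⟩ := (LinearMap.range T.toLinearMap).starProjection_apply_mem y
  have hz' : T z = (LinearMap.range T.toLinearMap).starProjection y := hz
  refine ⟨z - K.starProjection z, ⟨?_, K.sub_starProjection_mem_orthogonal z⟩, ?_⟩
  · rw [map_sub, hTK _ (K.starProjection_apply_mem z), sub_zero, hz']
  · rintro w ⟨hw, hw'⟩
    have h1 : w - (z - K.starProjection z) ∈ K := by
      change T (w - (z - K.starProjection z)) = 0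
      rw [map_sub, map_sub, hTK _ (K.starProjection_apply_mem z), hw, hz', sub_zero, sub_self]
    have h2 : w - (z - K.starProjection z) ∈ Kᗮ :=
      Kᗮ.sub_mem hw' (K.sub_starProjection_mem_orthogonal z)
    exact sub_eq_zero.1 (inner_self_eq_zero.1 ((Submodule.mem_orthogonal K _).1 h2 _ h1))

/-- The Moore-Penrose inverse `T†` of an operator between finite-dimensional spaces: `T† y` is
the least-squares solution of `T x = y` of smallest norm. -/
def moorePenrose [FiniteDimensional ℝ Y] (T : X →L[ℝ] Y) : Y →L[ℝ] X :=
  LinearMap.toContinuousLinearMap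
    { toFun := fun y => (existsUnique_isMinNormLeastSquares T y).choose
      map_add' := fun y₁ y₂ => by
        have h₁ := (existsUnique_isMinNormLeastSquares T y₁).choose_spec.1
        have h₂ := (existsUnique_isMinNormLeastSquares T y₂).choose_spec.1
        refine ((existsUnique_isMinNormLeastSquares T (y₁ + y₂)).choose_spec.2 _ ?_).symm
        simp only [isMinNormLeastSquares_iff] at h₁ h₂ ⊢
        exact ⟨by rw [map_add, map_add, h₁.1, h₂.1], Submodule.add_mem _ h₁.2 h₂.2⟩
      map_smul' := fun c y => by
        have h := (existsUnique_isMinNormLeastSquares T y).choose_spec.1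
        refine ((existsUnique_isMinNormLeastSquares T (c • y)).choose_spec.2 _ ?_).symm
        simp only [isMinNormLeastSquares_iff] at h ⊢
        exact ⟨by simp only [RingHom.id_apply]; rw [map_smul, map_smul, h.1],
          Submodule.smul_mem _ _ h.2⟩ }

theorem moorePenrose_spec [FiniteDimensional ℝ Y] (T : X →L[ℝ] Y) (y : Y) :
    IsMinNormLeastSquares T y (moorePenrose T y) :=
  (existsUnique_isMinNormLeastSquares T y).choose_spec.1

end MoorePenrose

/-! ### The space `L²(0, 2π)` and the integro-differential operator -/

/-- Lebesgue measure on `(0, 2π)`. -/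
abbrev mu : Measure ℝ := volume.restrict (Set.Ioo 0 (2 * Real.pi))

/-- The real Hilbert space `L²(0, 2π)`. -/
abbrev L2 : Type := Lp ℝ 2 mu

/-- `x ↦ (1 / Γ(p)) ∫₀ˣ (x - t)^(p - 1) φ(t) dt` (used for `p ≥ 1`). -/
def volterraFun (p : ℕ) (φ : ℝ → ℝ) (x : ℝ) : ℝ :=
  1 / Real.Gamma p * ∫ t in (0 : ℝ)..x, (x - t) ^ (p - 1) * φ t

theorem volterraFun_congr (p : ℕ) {φ ψ : ℝ → ℝ} (h : φ =ᵐ[mu] ψ) {x : ℝ}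
    (hx : x ∈ Set.Ioo 0 (2 * Real.pi)) : volterraFun p φ x = volterraFun p ψ x := by
  unfold volterraFun
  congr 1
  rw [intervalIntegral.integral_of_le hx.1.le, intervalIntegral.integral_of_le hx.1.le]
  have h1 : φ =ᵐ[volume.restrict (Set.Ioc 0 x)] ψ :=
    ae_restrict_of_ae_restrict_of_subset
      (fun t ht => ⟨ht.1, ht.2.trans_lt hx.2⟩ : Set.Ioc 0 x ⊆ Set.Ioo 0 (2 * Real.pi)) h
  exact integral_congr_ae (h1.mono fun t ht => by simp only [ht])

theorem integrable_coe (φ : L2) : Integrable φ mu :=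
  (Lp.memLp φ).integrable (by norm_num)

theorem integral_abs_le (φ : L2) :
    ∫ t, |φ t| ∂mu ≤ (mu Set.univ ^ ((1 : ℝ) - 1 / 2)).toReal * ‖φ‖ := by
  have h := eLpNorm_le_eLpNorm_mul_rpow_measure_univ (μ := mu) (p := 1) (q := 2)
    (by norm_num) (Lp.aestronglyMeasurable φ)
  have h1 : ∫ t, |φ t| ∂mu = (eLpNorm φ 1 mu).toReal := by
    rw [eLpNorm_one_eq_lintegral_enorm,
      ← integral_norm_eq_lintegral_enorm (Lp.aestronglyMeasurable φ)]
    rfl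
  rw [h1, Lp.norm_def, mul_comm, ← ENNReal.toReal_mul]
  refine ENNReal.toReal_mono ?_ (by simpa using h)
  exact ENNReal.mul_ne_top (Lp.eLpNorm_ne_top φ)
    (ENNReal.rpow_ne_top_of_nonneg (by norm_num) (measure_ne_top _ _))

theorem intervalIntegrable_kernel (p : ℕ) (φ : L2) {x : ℝ}
    (hx : x ∈ Set.Ioo 0 (2 * Real.pi)) :
    IntervalIntegrable (fun t => (x - t) ^ (p - 1) * φ t) volume 0 x := by
  have h : IntervalIntegrable φ volume 0 x := by
    rw [intervalIntegrable_iff_integrableOn_Ioc_of_le hx.1.le]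
    exact IntegrableOn.mono_set (integrable_coe φ)
      (fun t ht => ⟨ht.1, ht.2.trans_lt hx.2⟩)
  exact h.continuousOn_mul (by fun_prop)

theorem norm_volterraFun_le (p : ℕ) (φ : L2) {x : ℝ} (hx : x ∈ Set.Ioo 0 (2 * Real.pi)) :
    ‖volterraFun p φ x‖ ≤
      |1 / Real.Gamma p| * ((2 * Real.pi) ^ (p - 1) * ∫ t, |φ t| ∂mu) := by
  unfold volterraFun
  rw [norm_mul, Real.norm_eq_abs]
  refine mul_le_mul_of_nonneg_left ?_ (abs_nonneg _)
  have hsub : Set.Ioc 0 x ⊆ Set.Ioo 0 (2 * Real.pi) := fun t ht => ⟨ht.1, ht.2.trans_lt hx.2⟩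
  have hint : IntegrableOn (fun t => |φ t|) (Set.Ioo 0 (2 * Real.pi)) :=
    (integrable_coe φ).abs
  calc ‖∫ t in (0 : ℝ)..x, (x - t) ^ (p - 1) * φ t‖
      ≤ ∫ t in (0 : ℝ)..x, ‖(x - t) ^ (p - 1) * φ t‖ :=
        intervalIntegral.norm_integral_le_integral_norm hx.1.le
    _ = ∫ t in Set.Ioc 0 x, ‖(x - t) ^ (p - 1) * φ t‖ :=
        intervalIntegral.integral_of_le hx.1.le
    _ ≤ ∫ t in Set.Ioc 0 x, (2 * Real.pi) ^ (p - 1) * |φ t| := by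
        refine setIntegral_mono_on ?_ ((hint.mono_set hsub).const_mul _) measurableSet_Ioc ?_
        · exact ((intervalIntegrable_iff_integrableOn_Ioc_of_le hx.1.le).1
            (intervalIntegrable_kernel p φ hx)).norm
        · intro t ht
          rw [norm_mul, norm_pow, Real.norm_eq_abs, Real.norm_eq_abs]
          refine mul_le_mul_of_nonneg_right ?_ (abs_nonneg _)
          refine pow_le_pow_left₀ (abs_nonneg _) ?_ _
          rw [abs_le]
          constructor <;> linarith [ht.1, ht.2, hx.1, hx.2]
    _ = (2 * Real.pi) ^ (p - 1) * ∫ t in Set.Ioc 0 x, |φ t| := integral_const_mul _ _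
    _ ≤ (2 * Real.pi) ^ (p - 1) * ∫ t, |φ t| ∂mu := by
        refine mul_le_mul_of_nonneg_left ?_ (by positivity)
        exact setIntegral_mono_set hint (Filter.Eventually.of_forall fun t => abs_nonneg _)
          (Filter.Eventually.of_forall hsub)

theorem aestronglyMeasurable_volterraFun (p : ℕ) (φ : L2) :
    AEStronglyMeasurable (volterraFun p φ) mu := by
  have hφ : StronglyMeasurable φ := Lp.stronglyMeasurable φ
  have h1 : StronglyMeasurable (fun z : ℝ × ℝ =>
      Set.indicator {z : ℝ × ℝ | 0 < z.2 ∧ z.2 ≤ z.1}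
        (fun z => (z.1 - z.2) ^ (p - 1) * φ z.2) z) := by
    refine StronglyMeasurable.indicator ?_ ?_
    · exact (by fun_prop : Continuous fun z : ℝ × ℝ => (z.1 - z.2) ^ (p - 1)).stronglyMeasurable.mul
        (hφ.comp_measurable measurable_snd)
    · exact (measurableSet_lt measurable_const measurable_snd).inter
        (measurableSet_le measurable_snd measurable_fst)
  have h2 : StronglyMeasurable fun x : ℝ => 1 / Real.Gamma p * ∫ t,
      Set.indicator {z : ℝ × ℝ | 0 < z.2 ∧ z.2 ≤ z.1}
        (fun z => (z.1 - z.2) ^ (p - 1) * φ z.2) (x, t) :=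
    h1.integral_prod_right.const_mul _
  refine h2.aestronglyMeasurable.congr ?_
  refine ae_restrict_of_forall_mem measurableSet_Ioo fun x hx => ?_
  unfold volterraFun
  rw [intervalIntegral.integral_of_le hx.1.le, ← integral_indicator measurableSet_Ioc]
  rfl

theorem memLp_volterraFun (p : ℕ) (φ : L2) : MemLp (volterraFun p φ) 2 mu :=
  MemLp.of_bound (aestronglyMeasurable_volterraFun p φ) _
    (ae_restrict_of_forall_mem measurableSet_Ioo fun _ hx => norm_volterraFun_le p φ hx)

/-- The integro-differential operator `A^(p) : L²(0, 2π) → L²(0, 2π)`,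
`(A^(p) φ)(x) = (1 / Γ(p)) ∫₀ˣ (x - t)^(p - 1) φ(t) dt`. -/
def opA (p : ℕ) : L2 →L[ℝ] L2 :=
  LinearMap.mkContinuousOfExistsBound
    { toFun := fun φ => (memLp_volterraFun p φ).toLp (volterraFun p φ)
      map_add' := fun φ ψ => by
        rw [← MemLp.toLp_add]
        refine (MemLp.toLp_eq_toLp_iff _ _).2
          (ae_restrict_of_forall_mem measurableSet_Ioo fun x hx => ?_)
        rw [volterraFun_congr p (Lp.coeFn_add φ ψ) hx]
        simp only [volterraFun, Pi.add_apply, mul_add]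
        rw [intervalIntegral.integral_add (intervalIntegrable_kernel p φ hx)
          (intervalIntegrable_kernel p ψ hx), mul_add]
      map_smul' := fun c φ => by
        rw [RingHom.id_apply, ← MemLp.toLp_const_smul]
        refine (MemLp.toLp_eq_toLp_iff _ _).2
          (ae_restrict_of_forall_mem measurableSet_Ioo fun x hx => ?_)
        rw [volterraFun_congr p (Lp.coeFn_smul c φ) hx]
        simp only [volterraFun, Pi.smul_apply, smul_eq_mul, mul_left_comm _ c]
        rw [intervalIntegral.integral_const_mul, mul_left_comm] }
    (by
      refine ⟨mu.real Set.univ ^ ((2 : ENNReal).toReal)⁻¹ * (|1 / Real.Gamma p| *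
        ((2 * Real.pi) ^ (p - 1) * (mu Set.univ ^ ((1 : ℝ) - 1 / 2)).toReal)), fun φ => ?_⟩
      have hb : ∀ᵐ x ∂mu, ‖((memLp_volterraFun p φ).toLp (volterraFun p φ) : L2) x‖ ≤
          |1 / Real.Gamma p| * ((2 * Real.pi) ^ (p - 1) *
            ((mu Set.univ ^ ((1 : ℝ) - 1 / 2)).toReal * ‖φ‖)) := by
        filter_upwards [(memLp_volterraFun p φ).coeFn_toLp,
          ae_restrict_mem measurableSet_Ioo] with x hx hx'
        rw [hx]
        refine (norm_volterraFun_le p φ hx').trans ?_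
        have := integral_abs_le φ
        gcongr
      refine (Lp.norm_le_of_ae_bound (by positivity) hb).trans (le_of_eq ?_)
      simp only [mul_assoc]
      rfl)

theorem opA_ae_eq (p : ℕ) (φ : L2) : opA p φ =ᵐ[mu] volterraFun p φ :=
  (memLp_volterraFun p φ).coeFn_toLp

/-! ### The trigonometric Galerkin scheme -/

theorem memLp_of_continuous {f : ℝ → ℝ} (hf : Continuous f) : MemLp f 2 mu := by
  have h := hf.continuousOn (s := Set.Icc 0 (2 * Real.pi))
  obtain ⟨C, hC⟩ := isCompact_Icc.exists_bound_of_continuousOn h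
  exact MemLp.of_bound hf.aestronglyMeasurable C
    (ae_restrict_of_forall_mem measurableSet_Ioo fun x hx => hC x ⟨hx.1.le, hx.2.le⟩)

/-- The constant function `1 / √(2π)` in `L²(0, 2π)`. -/
def constVec : L2 :=
  (memLp_of_continuous (f := fun _ => 1 / Real.sqrt (2 * Real.pi)) (by fun_prop)).toLp _

/-- The function `cos (k t) / √π` in `L²(0, 2π)`. -/
def cosVec (k : ℕ) : L2 :=
  (memLp_of_continuous (f := fun t => Real.cos (k * t) / Real.sqrt Real.pi) (by fun_prop)).toLp _

/-- The function `sin (k t) / √π` in `L²(0, 2π)`. -/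
def sinVec (k : ℕ) : L2 :=
  (memLp_of_continuous (f := fun t => Real.sin (k * t) / Real.sqrt Real.pi) (by fun_prop)).toLp _

/-- The trigonometric polynomials of degree at most `n`: the span of `1 / √(2π)`,
`cos (k t) / √π` and `sin (k t) / √π`, `1 ≤ k ≤ n`. -/
def trigSpace (n : ℕ) : Submodule ℝ L2 :=
  Submodule.span ℝ ({constVec} ∪ cosVec '' Set.Icc 1 n ∪ sinVec '' Set.Icc 1 n)

instance (n : ℕ) : FiniteDimensional ℝ (trigSpace n) :=
  FiniteDimensional.span_of_finite ℝ
    (((Set.finite_singleton _).union ((Set.finite_Icc 1 n).image _)).union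
      ((Set.finite_Icc 1 n).image _))

/-- The orthogonal projection `P_n` of `L²(0, 2π)` onto `X_n`. -/
def projP (n : ℕ) : L2 →L[ℝ] trigSpace n := (trigSpace n).orthogonalProjectionOnto

/-- The Galerkin operator `A_n^(p) = P_n A^(p) P_n : X_n → X_n`. -/
def galerkinOp (p n : ℕ) : trigSpace n →L[ℝ] trigSpace n :=
  projP n ∘L opA p ∘L (trigSpace n).subtypeL ∘L projP n ∘L (trigSpace n).subtypeL

/-- The Groetsch regularizer `R_n^(p) = A_n^(p)† P_n A^(p)`, as an operator from `L²(0, 2π)` to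
`X_n ⊆ L²(0, 2π)`. -/
def groetschR (p n : ℕ) : L2 →L[ℝ] L2 :=
  (trigSpace n).subtypeL ∘L moorePenrose (galerkinOp p n) ∘L projP n ∘L opA p

/-! ### The explicit constants -/

/-- The constants `C_1^(p), …, C_6^(p)` for `p = 1, 2, 3`. -/
def decayConst : ℕ → Fin 6 → ℝ
  | 1 => ![0, 0, 0, Real.sqrt 2 / Real.pi, 2 / Real.pi, 0]
  | 2 => ![Real.sqrt 2, 2, Real.pi, 3 * Real.sqrt 2 / 2, 3, 5]
  | 3 => ![11 * Real.sqrt 2, 23, 11 * Real.pi, 44 * Real.sqrt 2 / 3, 30, 48]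
  | _ => 0

/-- `κ^(p) = √(∑ (C_i^(p))²)`. -/
def kappa (p : ℕ) : ℝ := Real.sqrt (∑ i, decayConst p i ^ 2)

/-- `γ^(p) = 1 + κ^(p)`. -/
def gammaConst (p : ℕ) : ℝ := 1 + kappa p

end TrigGalerkin

end

noncomputable section

namespace TrigGalerkin

open Real (pi)
open scoped RealInnerProductSpace

/-! ### Continuous functions in `L²(0, 2π)` -/

/-! Write A = A^(p), h = n + 1/2. For given φ put u = R_n φ, ψ = φ - P_n φ and v = u - P_n φ. If A_n
is injective on the finite-dimensional X_n, then u solves the Galerkin equation exactly and A(v - ψ)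
⊥ X_n. So everything reduces to a stability estimate: v ∈ X_n, ψ ⊥ X_n and A(v - ψ) ⊥ X_n imply ‖v‖
≤ c‖ψ‖ with c independent of n. It yields ‖R_n‖ ≤ 1 + c and, for ψ = 0, the injectivity itself
(`norm_groetschR_apply_le`).

Put w = v - ψ and M_j = ⟨(2π - t)^j / j!, w⟩. Moving A onto the test functions (`inner_toL2_opA`)
gives ⟨cos kt, w⟩ = M₀ - k² M₂ and ⟨sin kt, w⟩ = -k M₁ for 1 ≤ k ≤ n, where terms with index j ≥ p
are absent; testing with 1 gives M_p = 0. Since ψ ⊥ X_n, these are the Fourier data of v, so at most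
three numbers determine v (`eq_trigVec_of_coeff`, `norm_sq_le_of_coeff`).

Expanding (2π - t)^j / j! in the mean-zero polynomials `bern1`, `bern2`, `bern3` closes a p × p
linear system for these numbers, with the ⟨bern_j, ψ⟩ as data. Only the Fourier tail of bern_j
beyond n sees ψ, so |⟨bern_j, ψ⟩| ≤ √(4π) h^(1/2 - j) ‖ψ‖, which exactly offsets the growth in n of
the norm of v (`exists_scale`, `norm_le_of_scaled`). After elimination the leading coefficient is π,
π² - 2T or π² - 4T up to sign, where T ∈ [0, 2] is a scaled tail of ζ(2) (`scaled_tail_mem`); it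
stays away from 0 because π² > 8. The resulting c are 2/π, 2.8 and 17, all below κ. -/

/-- The class in `L²(0, 2π)` of a continuous function. -/
def toL2 : C(ℝ, ℝ) →ₗ[ℝ] L2 where
  toFun f := (memLp_of_continuous f.continuous).toLp f
  map_add' _ _ := rfl
  map_smul' _ _ := rfl

theorem coeFn_toL2 (f : C(ℝ, ℝ)) : toL2 f =ᵐ[mu] f :=
  (memLp_of_continuous f.continuous).coeFn_toLp

theorem inner_toL2_left (f : C(ℝ, ℝ)) (φ : L2) : ⟪toL2 f, φ⟫ = ∫ t, f t * φ t ∂mu := by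
  rw [L2.inner_def]
  refine integral_congr_ae ?_
  filter_upwards [coeFn_toL2 f] with t ht
  rw [ht]
  simp [mul_comm]

theorem inner_toL2_toL2 (f g : C(ℝ, ℝ)) :
    ⟪toL2 f, toL2 g⟫ = ∫ t in (0 : ℝ)..2 * pi, f t * g t := by
  rw [inner_toL2_left, intervalIntegral.integral_of_le Real.two_pi_pos.le,
    ← integral_Ioc_eq_integral_Ioo.symm]
  refine integral_congr_ae ?_
  filter_upwards [coeFn_toL2 g] with t ht
  rw [ht]

/-- `t ↦ cos (k t)`. -/
def cosC (k : ℕ) : C(ℝ, ℝ) := ⟨fun t => Real.cos (k * t), by fun_prop⟩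

/-- `t ↦ sin (k t)`. -/
def sinC (k : ℕ) : C(ℝ, ℝ) := ⟨fun t => Real.sin (k * t), by fun_prop⟩

/-- The Bernoulli-type polynomial `π - t = ∑ 2 sin (k t) / k`. -/
def bern1 : C(ℝ, ℝ) := ⟨fun t => pi - t, by fun_prop⟩

/-- The Bernoulli-type polynomial `π² / 6 - (π - t)² / 2 = -∑ 2 cos (k t) / k²`. -/
def bern2 : C(ℝ, ℝ) := ⟨fun t => pi ^ 2 / 6 - (pi - t) ^ 2 / 2, by fun_prop⟩

/-- The Bernoulli-type polynomial `((π - t)³ - π² (π - t)) / 6 = -∑ 2 sin (k t) / k³`. -/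
def bern3 : C(ℝ, ℝ) := ⟨fun t => ((pi - t) ^ 3 - pi ^ 2 * (pi - t)) / 6, by fun_prop⟩

@[simp] theorem cosC_apply (k : ℕ) (t : ℝ) : cosC k t = Real.cos (k * t) := rfl
@[simp] theorem sinC_apply (k : ℕ) (t : ℝ) : sinC k t = Real.sin (k * t) := rfl
@[simp] theorem bern1_apply (t : ℝ) : bern1 t = pi - t := rfl
@[simp] theorem bern2_apply (t : ℝ) : bern2 t = pi ^ 2 / 6 - (pi - t) ^ 2 / 2 := rfl
@[simp] theorem bern3_apply (t : ℝ) : bern3 t = ((pi - t) ^ 3 - pi ^ 2 * (pi - t)) / 6 := rfl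

/-! ### Integrals of polynomials against trigonometric functions -/

section Chain

variable {f₀ f₁ f₂ f₃ : ℝ → ℝ} {k : ℝ}

theorem hasDerivAt_sin_const_mul (k t : ℝ) :
    HasDerivAt (fun t => Real.sin (k * t)) (k * Real.cos (k * t)) t := by
  simpa [mul_comm] using ((hasDerivAt_id t).const_mul k).sin

theorem hasDerivAt_cos_const_mul (k t : ℝ) :
    HasDerivAt (fun t => Real.cos (k * t)) (-(k * Real.sin (k * t))) t := by
  simpa [mul_comm] using ((hasDerivAt_id t).const_mul k).cos

/-- Repeated integration by parts against `cos (k t)`. -/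
theorem integral_mul_cos (hk : k ≠ 0) (h₀ : ∀ t, HasDerivAt f₀ (f₁ t) t)
    (h₁ : ∀ t, HasDerivAt f₁ (f₂ t) t) (h₂ : ∀ t, HasDerivAt f₂ (f₃ t) t)
    (h₃ : ∀ t, HasDerivAt f₃ 0 t) (a b : ℝ) :
    ∫ t in a..b, f₀ t * Real.cos (k * t) =
      (f₀ b / k - f₂ b / k ^ 3) * Real.sin (k * b) + (f₁ b / k ^ 2 - f₃ b / k ^ 4)
        * Real.cos (k * b) - ((f₀ a / k - f₂ a / k ^ 3) * Real.sin (k * a)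
        + (f₁ a / k ^ 2 - f₃ a / k ^ 4) * Real.cos (k * a)) := by
  have hc : Continuous f₀ := continuous_iff_continuousAt.2 fun t => (h₀ t).continuousAt
  refine intervalIntegral.integral_eq_sub_of_hasDerivAt
    (f := fun t => (f₀ t / k - f₂ t / k ^ 3) * Real.sin (k * t)
      + (f₁ t / k ^ 2 - f₃ t / k ^ 4) * Real.cos (k * t)) (fun t _ => ?_)
    (Continuous.intervalIntegrable (by fun_prop) _ _)
  refine HasDerivAt.congr_deriv (((((h₀ t).div_const k).sub ((h₂ t).div_const (k ^ 3))).mul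
    (hasDerivAt_sin_const_mul k t)).add ((((h₁ t).div_const (k ^ 2)).sub
    ((h₃ t).div_const (k ^ 4))).mul (hasDerivAt_cos_const_mul k t))) ?_
  simp only [Pi.sub_apply]
  field_simp
  ring

/-- Repeated integration by parts against `sin (k t)`. -/
theorem integral_mul_sin (hk : k ≠ 0) (h₀ : ∀ t, HasDerivAt f₀ (f₁ t) t)
    (h₁ : ∀ t, HasDerivAt f₁ (f₂ t) t) (h₂ : ∀ t, HasDerivAt f₂ (f₃ t) t)
    (h₃ : ∀ t, HasDerivAt f₃ 0 t) (a b : ℝ) :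
    ∫ t in a..b, f₀ t * Real.sin (k * t) =
      (f₁ b / k ^ 2 - f₃ b / k ^ 4) * Real.sin (k * b) - (f₀ b / k - f₂ b / k ^ 3)
        * Real.cos (k * b) - ((f₁ a / k ^ 2 - f₃ a / k ^ 4) * Real.sin (k * a)
        - (f₀ a / k - f₂ a / k ^ 3) * Real.cos (k * a)) := by
  have hc : Continuous f₀ := continuous_iff_continuousAt.2 fun t => (h₀ t).continuousAt
  refine intervalIntegral.integral_eq_sub_of_hasDerivAt
    (f := fun t => (f₁ t / k ^ 2 - f₃ t / k ^ 4) * Real.sin (k * t)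
      - (f₀ t / k - f₂ t / k ^ 3) * Real.cos (k * t)) (fun t _ => ?_)
    (Continuous.intervalIntegrable (by fun_prop) _ _)
  refine HasDerivAt.congr_deriv (((((h₁ t).div_const (k ^ 2)).sub ((h₃ t).div_const (k ^ 4))).mul
    (hasDerivAt_sin_const_mul k t)).sub ((((h₀ t).div_const k).sub
    ((h₂ t).div_const (k ^ 3))).mul (hasDerivAt_cos_const_mul k t))) ?_
  simp only [Pi.sub_apply]
  field_simp
  ring

end Chain

theorem hasDerivAt_bern1 (t : ℝ) : HasDerivAt bern1 (-1) t :=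
  (hasDerivAt_id t).const_sub pi

theorem hasDerivAt_bern2 (t : ℝ) : HasDerivAt bern2 (bern1 t) t := by
  refine HasDerivAt.congr_deriv
    ((((hasDerivAt_bern1 t).pow 2).div_const 2).const_sub (pi ^ 2 / 6)) ?_
  simp
  ring

theorem hasDerivAt_bern3 (t : ℝ) : HasDerivAt bern3 (bern2 t) t := by
  refine HasDerivAt.congr_deriv ((((hasDerivAt_bern1 t).pow 3).sub
    ((hasDerivAt_bern1 t).const_mul (pi ^ 2))).div_const 6) ?_
  simp
  ring

theorem sin_nat_mul_two_pi' (k : ℕ) : Real.sin (k * (2 * pi)) = 0 := by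
  rw [show (k : ℝ) * (2 * pi) = (2 * k : ℕ) * pi by push_cast; ring]
  exact Real.sin_nat_mul_pi _

theorem integral_cos_int_mul {m : ℤ} (hm : m ≠ 0) :
    ∫ t in (0 : ℝ)..2 * pi, Real.cos (m * t) = 0 := by
  rw [intervalIntegral.integral_comp_mul_left _ (Int.cast_ne_zero.2 hm), integral_cos,
    show (m : ℝ) * (2 * pi) = (2 * m : ℤ) * pi by push_cast; ring, Real.sin_int_mul_pi]
  simp

theorem integral_sin_int_mul (m : ℤ) : ∫ t in (0 : ℝ)..2 * pi, Real.sin (m * t) = 0 := by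
  rcases eq_or_ne m 0 with rfl | hm
  · simp
  · rw [intervalIntegral.integral_comp_mul_left _ (Int.cast_ne_zero.2 hm), integral_sin,
      Real.cos_int_mul_two_pi]
    simp

/-! ### Orthogonality relations of the trigonometric system. -/

theorem inner_one_one : ⟪toL2 1, toL2 1⟫ = 2 * pi := by
  rw [inner_toL2_toL2]
  simp

theorem inner_one_cosC {k : ℕ} (hk : k ≠ 0) : ⟪toL2 1, toL2 (cosC k)⟫ = 0 := by
  simpa [inner_toL2_toL2] using integral_cos_int_mul (m := k) (by exact_mod_cast hk)

theorem inner_one_sinC (k : ℕ) : ⟪toL2 1, toL2 (sinC k)⟫ = 0 := by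
  simpa [inner_toL2_toL2] using integral_sin_int_mul k

theorem inner_cosC_cosC {j k : ℕ} (hk : k ≠ 0) :
    ⟪toL2 (cosC j), toL2 (cosC k)⟫ = if j = k then pi else 0 := by
  rw [inner_toL2_toL2]
  have h : ∀ t : ℝ, cosC j t * cosC k t =
      (Real.cos ((j - k : ℤ) * t) + Real.cos ((j + k : ℤ) * t)) / 2 := by
    intro t
    push_cast
    rw [sub_mul, add_mul, Real.cos_sub, Real.cos_add, cosC_apply, cosC_apply]
    ring
  simp only [h]
  rw [intervalIntegral.integral_div, intervalIntegral.integral_add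
    (Continuous.intervalIntegrable (by fun_prop) _ _)
    (Continuous.intervalIntegrable (by fun_prop) _ _), integral_cos_int_mul (m := j + k) (by omega)]
  split_ifs with hjk
  · simp [hjk]
  · rw [integral_cos_int_mul (by omega)]
    simp

theorem inner_sinC_sinC {j k : ℕ} (hk : k ≠ 0) :
    ⟪toL2 (sinC j), toL2 (sinC k)⟫ = if j = k then pi else 0 := by
  rw [inner_toL2_toL2]
  have h : ∀ t : ℝ, sinC j t * sinC k t =
      (Real.cos ((j - k : ℤ) * t) - Real.cos ((j + k : ℤ) * t)) / 2 := by
    intro t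
    push_cast
    rw [sub_mul, add_mul, Real.cos_sub, Real.cos_add, sinC_apply, sinC_apply]
    ring
  simp only [h]
  rw [intervalIntegral.integral_div, intervalIntegral.integral_sub
    (Continuous.intervalIntegrable (by fun_prop) _ _)
    (Continuous.intervalIntegrable (by fun_prop) _ _), integral_cos_int_mul (m := j + k) (by omega)]
  split_ifs with hjk
  · simp [hjk]
  · rw [integral_cos_int_mul (by omega)]
    simp

theorem inner_cosC_sinC (j k : ℕ) : ⟪toL2 (cosC j), toL2 (sinC k)⟫ = 0 := by
  rw [inner_toL2_toL2]
  have h : ∀ t : ℝ, cosC j t * sinC k t =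
      (Real.sin ((j + k : ℤ) * t) - Real.sin ((j - k : ℤ) * t)) / 2 := by
    intro t
    push_cast
    rw [sub_mul, add_mul, Real.sin_sub, Real.sin_add, cosC_apply, sinC_apply]
    ring
  simp only [h]
  rw [intervalIntegral.integral_div, intervalIntegral.integral_sub
    (Continuous.intervalIntegrable (by fun_prop) _ _)
    (Continuous.intervalIntegrable (by fun_prop) _ _), integral_sin_int_mul, integral_sin_int_mul]
  simp

/-! ### Fourier coefficients of the Bernoulli-type polynomials. -/

section Bernoulli

variable {k : ℕ}

theorem inner_bern1_cosC (hk : k ≠ 0) : ⟪toL2 bern1, toL2 (cosC k)⟫ = 0 := by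
  rw [inner_toL2_toL2]
  have := integral_mul_cos (Nat.cast_ne_zero.2 hk : (k : ℝ) ≠ 0) hasDerivAt_bern1
    (fun t => hasDerivAt_const t _) (fun t => hasDerivAt_const t (0 : ℝ))
    (fun t => hasDerivAt_const t (0 : ℝ)) 0 (2 * pi)
  simp only [cosC_apply, this, sin_nat_mul_two_pi', Real.cos_nat_mul_two_pi]
  simp

theorem inner_bern1_sinC (hk : k ≠ 0) : ⟪toL2 bern1, toL2 (sinC k)⟫ = 2 * pi / k := by
  rw [inner_toL2_toL2]
  have := integral_mul_sin (Nat.cast_ne_zero.2 hk : (k : ℝ) ≠ 0) hasDerivAt_bern1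
    (fun t => hasDerivAt_const t _) (fun t => hasDerivAt_const t (0 : ℝ))
    (fun t => hasDerivAt_const t (0 : ℝ)) 0 (2 * pi)
  simp only [sinC_apply, this, sin_nat_mul_two_pi', Real.cos_nat_mul_two_pi]
  simp
  ring

theorem inner_bern2_cosC (hk : k ≠ 0) : ⟪toL2 bern2, toL2 (cosC k)⟫ = -(2 * pi / k ^ 2) := by
  rw [inner_toL2_toL2]
  have := integral_mul_cos (Nat.cast_ne_zero.2 hk : (k : ℝ) ≠ 0) hasDerivAt_bern2
    hasDerivAt_bern1 (fun t => hasDerivAt_const t _) (fun t => hasDerivAt_const t (0 : ℝ))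
    0 (2 * pi)
  simp only [cosC_apply, this, sin_nat_mul_two_pi', Real.cos_nat_mul_two_pi]
  simp
  ring

theorem inner_bern2_sinC (hk : k ≠ 0) : ⟪toL2 bern2, toL2 (sinC k)⟫ = 0 := by
  rw [inner_toL2_toL2]
  have := integral_mul_sin (Nat.cast_ne_zero.2 hk : (k : ℝ) ≠ 0) hasDerivAt_bern2
    hasDerivAt_bern1 (fun t => hasDerivAt_const t _) (fun t => hasDerivAt_const t (0 : ℝ))
    0 (2 * pi)
  simp only [sinC_apply, this, sin_nat_mul_two_pi', Real.cos_nat_mul_two_pi]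
  simp
  ring

theorem inner_bern3_cosC (hk : k ≠ 0) : ⟪toL2 bern3, toL2 (cosC k)⟫ = 0 := by
  rw [inner_toL2_toL2]
  have := integral_mul_cos (Nat.cast_ne_zero.2 hk : (k : ℝ) ≠ 0) hasDerivAt_bern3
    hasDerivAt_bern2 hasDerivAt_bern1 (fun t => hasDerivAt_const t _) 0 (2 * pi)
  simp only [cosC_apply, this, sin_nat_mul_two_pi', Real.cos_nat_mul_two_pi]
  simp
  ring

theorem inner_bern3_sinC (hk : k ≠ 0) : ⟪toL2 bern3, toL2 (sinC k)⟫ = -(2 * pi / k ^ 3) := by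
  rw [inner_toL2_toL2]
  have := integral_mul_sin (Nat.cast_ne_zero.2 hk : (k : ℝ) ≠ 0) hasDerivAt_bern3
    hasDerivAt_bern2 hasDerivAt_bern1 (fun t => hasDerivAt_const t _) 0 (2 * pi)
  simp only [sinC_apply, this, sin_nat_mul_two_pi', Real.cos_nat_mul_two_pi]
  simp
  ring

end Bernoulli

/-- A polynomial integral over `(0, 2π)` in the centred variable `π - t`. -/
theorem integral_even_poly (a b c d : ℝ) : ∫ t in (0 : ℝ)..2 * pi,
    (a + b * (pi - t) ^ 2 + c * (pi - t) ^ 4 + d * (pi - t) ^ 6) =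
      2 * (a * pi + b * pi ^ 3 / 3 + c * pi ^ 5 / 5 + d * pi ^ 7 / 7) := by
  rw [intervalIntegral.integral_comp_sub_left
    (fun u => a + b * u ^ 2 + c * u ^ 4 + d * u ^ 6) pi]
  rw [intervalIntegral.integral_add
      (Continuous.intervalIntegrable (by fun_prop) _ _)
      (Continuous.intervalIntegrable (by fun_prop) _ _),
    intervalIntegral.integral_add
      (Continuous.intervalIntegrable (by fun_prop) _ _)
      (Continuous.intervalIntegrable (by fun_prop) _ _),
    intervalIntegral.integral_add
      (Continuous.intervalIntegrable (by fun_prop) _ _)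
      (Continuous.intervalIntegrable (by fun_prop) _ _)]
  simp only [intervalIntegral.integral_const_mul, integral_pow, intervalIntegral.integral_const,
    smul_eq_mul]
  push_cast
  ring

/-! ### Means and norms of the Bernoulli-type polynomials. -/

theorem inner_bern1_one : ⟪toL2 bern1, toL2 1⟫ = 0 := by
  have h : ∀ t, bern1 t * (1 : C(ℝ, ℝ)) t = pi - t := fun t => by simp
  simp only [inner_toL2_toL2, h]
  rw [intervalIntegral.integral_comp_sub_left (fun u => u) pi, integral_id]
  ring

theorem inner_bern2_one : ⟪toL2 bern2, toL2 1⟫ = 0 := by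
  have h : ∀ t, bern2 t * (1 : C(ℝ, ℝ)) t =
      pi ^ 2 / 6 + (-1 / 2) * (pi - t) ^ 2 + 0 * (pi - t) ^ 4 + 0 * (pi - t) ^ 6 := fun t => by
    simp
    ring
  simp only [inner_toL2_toL2, h, integral_even_poly]
  ring

theorem inner_bern3_one : ⟪toL2 bern3, toL2 1⟫ = 0 := by
  have h : ∀ t, bern3 t * (1 : C(ℝ, ℝ)) t = (pi - t) ^ 3 / 6 - pi ^ 2 / 6 * (pi - t) :=
    fun t => by
      simp
      ring
  simp only [inner_toL2_toL2, h]
  rw [intervalIntegral.integral_comp_sub_left (fun u => u ^ 3 / 6 - pi ^ 2 / 6 * u) pi,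
    intervalIntegral.integral_sub (Continuous.intervalIntegrable (by fun_prop) _ _)
      (Continuous.intervalIntegrable (by fun_prop) _ _), intervalIntegral.integral_const_mul,
    intervalIntegral.integral_div, integral_id, integral_pow]
  push_cast
  ring

theorem inner_bern1_bern1 : ⟪toL2 bern1, toL2 bern1⟫ = 2 * pi ^ 3 / 3 := by
  have h : ∀ t, bern1 t * bern1 t =
      0 + 1 * (pi - t) ^ 2 + 0 * (pi - t) ^ 4 + 0 * (pi - t) ^ 6 := fun t => by
    simp only [bern1_apply]
    ring
  simp only [inner_toL2_toL2, h, integral_even_poly]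
  ring

theorem inner_bern2_bern2 : ⟪toL2 bern2, toL2 bern2⟫ = 2 * pi ^ 5 / 45 := by
  have h : ∀ t, bern2 t * bern2 t = pi ^ 4 / 36 + (-(pi ^ 2 / 6)) * (pi - t) ^ 2
      + 1 / 4 * (pi - t) ^ 4 + 0 * (pi - t) ^ 6 := fun t => by
    simp only [bern2_apply]
    ring
  simp only [inner_toL2_toL2, h, integral_even_poly]
  ring

theorem inner_bern3_bern3 : ⟪toL2 bern3, toL2 bern3⟫ = 4 * pi ^ 7 / 945 := by
  have h : ∀ t, bern3 t * bern3 t = 0 + pi ^ 4 / 36 * (pi - t) ^ 2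
      + (-(pi ^ 2 / 18)) * (pi - t) ^ 4 + 1 / 36 * (pi - t) ^ 6 := fun t => by
    simp only [bern3_apply]
    ring
  simp only [inner_toL2_toL2, h, integral_even_poly]
  ring

section TrigonometricPolynomials

/-! ### Trigonometric polynomials -/

theorem toLp_eq_toL2 {f : ℝ → ℝ} (hf : MemLp f 2 mu) (g : C(ℝ, ℝ)) (h : ∀ t, f t = g t) :
    hf.toLp f = toL2 g :=
  (MemLp.toLp_eq_toLp_iff hf (memLp_of_continuous g.continuous)).2 (Filter.Eventually.of_forall h)

theorem constVec_eq : constVec = (1 / Real.sqrt (2 * pi)) • toL2 1 := by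
  rw [← map_smul]
  refine toLp_eq_toL2 _ _ fun t => ?_
  simp

theorem cosVec_eq (k : ℕ) : cosVec k = (1 / Real.sqrt pi) • toL2 (cosC k) := by
  rw [← map_smul]
  refine toLp_eq_toL2 _ _ fun t => ?_
  simp [div_eq_inv_mul]

theorem sinVec_eq (k : ℕ) : sinVec k = (1 / Real.sqrt pi) • toL2 (sinC k) := by
  rw [← map_smul]
  refine toLp_eq_toL2 _ _ fun t => ?_
  simp [div_eq_inv_mul]

theorem one_div_sqrt_ne_zero {x : ℝ} (hx : 0 < x) : 1 / Real.sqrt x ≠ 0 :=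
  (one_div_pos.2 (Real.sqrt_pos.2 hx)).ne'

variable {n k : ℕ}

theorem toL2_one_mem : toL2 1 ∈ trigSpace n := by
  have h : constVec ∈ trigSpace n := Submodule.subset_span (Or.inl (Or.inl rfl))
  rw [constVec_eq] at h
  exact (Submodule.smul_mem_iff _ (one_div_sqrt_ne_zero Real.two_pi_pos)).1 h

theorem toL2_cosC_mem (hk : k ∈ Finset.Icc 1 n) : toL2 (cosC k) ∈ trigSpace n := by
  have h : cosVec k ∈ trigSpace n :=
    Submodule.subset_span (Or.inl (Or.inr ⟨k, Finset.mem_Icc.1 hk, rfl⟩))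
  rw [cosVec_eq] at h
  exact (Submodule.smul_mem_iff _ (one_div_sqrt_ne_zero Real.pi_pos)).1 h

theorem toL2_sinC_mem (hk : k ∈ Finset.Icc 1 n) : toL2 (sinC k) ∈ trigSpace n := by
  have h : sinVec k ∈ trigSpace n :=
    Submodule.subset_span (Or.inr ⟨k, Finset.mem_Icc.1 hk, rfl⟩)
  rw [sinVec_eq] at h
  exact (Submodule.smul_mem_iff _ (one_div_sqrt_ne_zero Real.pi_pos)).1 h

theorem mem_orthogonal_trigSpace {φ : L2} (h₁ : ⟪toL2 1, φ⟫ = 0)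
    (hc : ∀ k ∈ Finset.Icc 1 n, ⟪toL2 (cosC k), φ⟫ = 0)
    (hs : ∀ k ∈ Finset.Icc 1 n, ⟪toL2 (sinC k), φ⟫ = 0) : φ ∈ (trigSpace n)ᗮ := by
  rw [Submodule.mem_orthogonal]
  intro u hu
  induction hu using Submodule.span_induction with
  | mem u hu =>
    rcases hu with (rfl | ⟨k, hk, rfl⟩) | ⟨k, hk, rfl⟩
    · rw [constVec_eq, real_inner_smul_left, h₁, mul_zero]
    · rw [cosVec_eq, real_inner_smul_left, hc k (Finset.mem_Icc.2 hk), mul_zero]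
    · rw [sinVec_eq, real_inner_smul_left, hs k (Finset.mem_Icc.2 hk), mul_zero]
  | zero => exact inner_zero_left _
  | add u v _ _ hu hv => rw [inner_add_left, hu, hv, add_zero]
  | smul c u _ hu => rw [real_inner_smul_left, hu, mul_zero]

/-- The trigonometric polynomial `a + ∑_{1 ≤ k ≤ n} (α_k cos (k t) + β_k sin (k t))`. -/
def trigVec (n : ℕ) (a : ℝ) (α β : ℕ → ℝ) : L2 :=
  a • toL2 1 + ∑ k ∈ Finset.Icc 1 n, (α k • toL2 (cosC k) + β k • toL2 (sinC k))

variable {a : ℝ} {α β : ℕ → ℝ}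

theorem trigVec_mem : trigVec n a α β ∈ trigSpace n :=
  add_mem (Submodule.smul_mem _ _ toL2_one_mem) (sum_mem fun _ hk =>
    add_mem (Submodule.smul_mem _ _ (toL2_cosC_mem hk))
      (Submodule.smul_mem _ _ (toL2_sinC_mem hk)))

theorem inner_trigVec (f : L2) : ⟪f, trigVec n a α β⟫ = a * ⟪f, toL2 1⟫ +
    ∑ k ∈ Finset.Icc 1 n, (α k * ⟪f, toL2 (cosC k)⟫ + β k * ⟪f, toL2 (sinC k)⟫) := by
  simp only [trigVec, inner_add_right, inner_sum, real_inner_smul_right]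

theorem ne_zero_of_mem_Icc (hk : k ∈ Finset.Icc 1 n) : k ≠ 0 := by
  have := (Finset.mem_Icc.1 hk).1
  omega

theorem inner_one_trigVec : ⟪toL2 1, trigVec n a α β⟫ = 2 * pi * a := by
  rw [inner_trigVec, inner_one_one, Finset.sum_eq_zero, add_zero, mul_comm]
  intro k hk
  rw [inner_one_cosC (ne_zero_of_mem_Icc hk), inner_one_sinC]
  ring

theorem inner_cosC_trigVec (hk : k ∈ Finset.Icc 1 n) :
    ⟪toL2 (cosC k), trigVec n a α β⟫ = pi * α k := by
  rw [inner_trigVec, real_inner_comm, inner_one_cosC (ne_zero_of_mem_Icc hk),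
    Finset.sum_eq_single_of_mem k hk, inner_cosC_cosC (ne_zero_of_mem_Icc hk), inner_cosC_sinC,
    if_pos rfl]
  · ring
  · intro j hj hjk
    rw [inner_cosC_cosC (ne_zero_of_mem_Icc hj), inner_cosC_sinC, if_neg hjk.symm]
    ring

theorem inner_sinC_trigVec (hk : k ∈ Finset.Icc 1 n) :
    ⟪toL2 (sinC k), trigVec n a α β⟫ = pi * β k := by
  rw [inner_trigVec, real_inner_comm, inner_one_sinC,
    Finset.sum_eq_single_of_mem k hk, inner_sinC_sinC (ne_zero_of_mem_Icc hk), real_inner_comm,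
    inner_cosC_sinC, if_pos rfl]
  · ring
  · intro j hj hjk
    rw [inner_sinC_sinC (ne_zero_of_mem_Icc hj), real_inner_comm, inner_cosC_sinC,
      if_neg hjk.symm]
    ring

theorem norm_trigVec_sq : ‖trigVec n a α β‖ ^ 2 =
    2 * pi * a ^ 2 + pi * ∑ k ∈ Finset.Icc 1 n, (α k ^ 2 + β k ^ 2) := by
  rw [← real_inner_self_eq_norm_sq, inner_trigVec, real_inner_comm, inner_one_trigVec,
    Finset.mul_sum]
  congr 1
  · ring
  refine Finset.sum_congr rfl fun k hk => ?_
  rw [real_inner_comm, inner_cosC_trigVec hk, real_inner_comm, inner_sinC_trigVec hk]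
  ring

/-- Fourier coefficients determine an element of X_n: the difference lies both in X_n and in its
orthogonal complement. -/
theorem eq_trigVec {v : L2} (hv : v ∈ trigSpace n) (h₁ : ⟪toL2 1, v⟫ = 2 * pi * a)
    (hc : ∀ k ∈ Finset.Icc 1 n, ⟪toL2 (cosC k), v⟫ = pi * α k)
    (hs : ∀ k ∈ Finset.Icc 1 n, ⟪toL2 (sinC k), v⟫ = pi * β k) : v = trigVec n a α β := by
  have h₂ : v - trigVec n a α β ∈ trigSpace n := sub_mem hv trigVec_mem
  have h₃ : v - trigVec n a α β ∈ (trigSpace n)ᗮ := by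
    refine mem_orthogonal_trigSpace ?_ (fun k hk => ?_) fun k hk => ?_
    · rw [inner_sub_right, h₁, inner_one_trigVec, sub_self]
    · rw [inner_sub_right, hc k hk, inner_cosC_trigVec hk, sub_self]
    · rw [inner_sub_right, hs k hk, inner_sinC_trigVec hk, sub_self]
  exact sub_eq_zero.1 (inner_self_eq_zero.1 ((Submodule.mem_orthogonal _ _).1 h₃ _ h₂))

/-! ### Tails of zeta sums -/

theorem sum_Icc_le_of_hasSum {j : ℕ} {Z : ℝ}
    (h : HasSum (fun k : ℕ => 1 / (k : ℝ) ^ j) Z) (n : ℕ) :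
    ∑ k ∈ Finset.Icc 1 n, 1 / (k : ℝ) ^ j ≤ Z :=
  sum_le_hasSum _ (fun _ _ => by positivity) h

/-- With c = n + 1/2, the tail is compared to a telescoping sum: 1/(x + 1/2)² ≤ 1/x - 1/(x + 1),
while the remaining 2j powers are bounded by c^(-2j). The shift by 1/2 is what later gives T ≤ 2. -/
theorem hasSum_sub_sum_Icc_le {j : ℕ} {Z : ℝ}
    (h : HasSum (fun k : ℕ => 1 / (k : ℝ) ^ (2 * (j + 1))) Z) (n : ℕ) :
    Z - ∑ k ∈ Finset.Icc 1 n, 1 / (k : ℝ) ^ (2 * (j + 1)) ≤ 1 / (n + 1 / 2 : ℝ) ^ (2 * j + 1) := by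
  set c : ℝ := n + 1 / 2 with hc
  have hc0 : 0 < c := by positivity
  have hpart : ∀ m : ℕ, ∑ k ∈ Finset.range m, 1 / ((k + (n + 1) : ℕ) : ℝ) ^ (2 * (j + 1)) ≤
      1 / c ^ (2 * j) * (1 / c - 1 / (m + c)) := by
    intro m
    induction m with
    | zero => simp
    | succ m ih =>
      rw [Finset.sum_range_succ]
      have hm : (0 : ℝ) ≤ m := m.cast_nonneg
      have h1 : 1 / ((m + (n + 1) : ℕ) : ℝ) ^ (2 * (j + 1)) ≤
          1 / c ^ (2 * j) * (1 / (m + c) - 1 / ((m + 1 : ℕ) + c)) := by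
        have e : ((m + (n + 1) : ℕ) : ℝ) = m + c + 1 / 2 := by
          rw [hc]
          push_cast
          ring
        rw [e, mul_add, pow_add, one_div_mul_eq_div, le_div_iff₀ (by positivity)]
        have h2 : 1 / (m + c) - 1 / ((m + 1 : ℕ) + c) = 1 / ((m + c) * (m + c + 1)) := by
          push_cast
          field_simp
          ring
        rw [h2, div_mul_eq_mul_div, one_mul,
          div_le_div_iff₀ (by positivity) (by positivity), one_mul]
        have h3 : c ^ (2 * j) ≤ (m + c + 1 / 2) ^ (2 * j) :=
          pow_le_pow_left₀ hc0.le (by linarith) _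
        refine mul_le_mul h3 ?_ (by positivity) (by positivity)
        -- (x + 1/2)² exceeds x(x + 1) by 1/4, with x = m + c.
        nlinarith
      linarith
  have htail : HasSum (fun k : ℕ => 1 / ((k + (n + 1) : ℕ) : ℝ) ^ (2 * (j + 1)))
      (Z - ∑ k ∈ Finset.range (n + 1), 1 / (k : ℝ) ^ (2 * (j + 1))) :=
    (hasSum_nat_add_iff (f := fun k : ℕ => 1 / (k : ℝ) ^ (2 * (j + 1))) (n + 1)).2 (by simpa using h)
  -- The sums differ only by the index 0, whose term is 0 because division by zero gives 0.
  have hrange : ∑ k ∈ Finset.range (n + 1), 1 / (k : ℝ) ^ (2 * (j + 1)) =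
      ∑ k ∈ Finset.Icc 1 n, 1 / (k : ℝ) ^ (2 * (j + 1)) := by
    rw [Finset.sum_range_succ', Finset.range_eq_Ico,
      Finset.sum_Ico_add' (fun k : ℕ => 1 / (k : ℝ) ^ (2 * (j + 1))) 0 n 1]
    simp
    rfl
  rw [hrange] at htail
  refine le_of_tendsto' htail.tendsto_sum_nat fun m => (hpart m).trans ?_
  rw [pow_succ, ← one_div_mul_one_div]
  refine mul_le_mul_of_nonneg_left ?_ (by positivity)
  have : 0 ≤ 1 / ((m : ℝ) + c) := by positivity
  linarith

theorem hasSum_zeta_six : HasSum (fun n : ℕ => (1 : ℝ) / (n : ℝ) ^ 6) (pi ^ 6 / 945) := by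
  have h6 : bernoulli 6 = 1 / 42 := by
    rw [bernoulli_eq_bernoulli'_of_ne_one (by norm_num), bernoulli'_def]
    norm_num [Finset.sum_range_succ, Nat.choose, bernoulli'_def 5]
  convert hasSum_zeta_nat three_ne_zero using 1
  norm_num [h6, Nat.factorial]
  ring

/-! ### Distance of the Bernoulli polynomials from the trigonometric polynomials -/

/-- Cauchy-Schwarz after subtracting from f a trigonometric polynomial, which ψ cannot see. In the
applications this is the Fourier truncation of f, Z is a zeta value and S its partial sum, so the
squared distance is 4π times a zeta tail. -/
theorem inner_sq_le_of_mem_orthogonal {f ψ : L2} (hψ : ψ ∈ (trigSpace n)ᗮ) {S Z B : ℝ}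
    (hf : ⟪f, f⟫ = 4 * pi * Z) (hfT : ⟪f, trigVec n a α β⟫ = 4 * pi * S)
    (hT : ‖trigVec n a α β‖ ^ 2 = 4 * pi * S) (hB : Z - S ≤ B) :
    ⟪f, ψ⟫ ^ 2 ≤ 4 * pi * B * ‖ψ‖ ^ 2 := by
  have h0 : ⟪trigVec n a α β, ψ⟫ = 0 := (Submodule.mem_orthogonal _ _).1 hψ _ trigVec_mem
  have h1 : ⟪f, ψ⟫ = ⟪f - trigVec n a α β, ψ⟫ := by rw [inner_sub_left, h0, sub_zero]
  have h2 : ‖f - trigVec n a α β‖ ^ 2 = 4 * pi * (Z - S) := by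
    rw [norm_sub_sq_real, ← real_inner_self_eq_norm_sq f, hf, hfT, hT]
    ring
  rw [h1, ← sq_abs]
  calc |⟪f - trigVec n a α β, ψ⟫| ^ 2 ≤ (‖f - trigVec n a α β‖ * ‖ψ‖) ^ 2 :=
        pow_le_pow_left₀ (abs_nonneg _) (abs_real_inner_le_norm _ _) 2
    _ = 4 * pi * (Z - S) * ‖ψ‖ ^ 2 := by rw [mul_pow, h2]
    _ ≤ 4 * pi * B * ‖ψ‖ ^ 2 := by
      have := Real.pi_pos
      gcongr

variable {ψ : L2}

theorem inner_bern1_sq_le (hψ : ψ ∈ (trigSpace n)ᗮ) :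
    ⟪toL2 bern1, ψ⟫ ^ 2 ≤ 4 * pi * (1 / (n + 1 / 2 : ℝ)) * ‖ψ‖ ^ 2 := by
  have hz := hasSum_sub_sum_Icc_le (j := 0) hasSum_zeta_two n
  rw [mul_zero, zero_add, pow_one] at hz
  refine inner_sq_le_of_mem_orthogonal (a := 0) (α := 0) (β := fun k => 2 / k) hψ ?_ ?_ ?_ hz
  · rw [inner_bern1_bern1]
    ring
  · rw [inner_trigVec, inner_bern1_one, Finset.mul_sum, zero_mul, zero_add]
    refine Finset.sum_congr rfl fun k hk => ?_
    rw [inner_bern1_sinC (ne_zero_of_mem_Icc hk), Pi.zero_apply]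
    ring
  · rw [norm_trigVec_sq, Finset.mul_sum, Finset.mul_sum, zero_pow two_ne_zero, mul_zero, zero_add]
    refine Finset.sum_congr rfl fun k hk => ?_
    rw [Pi.zero_apply]
    ring

theorem inner_bern2_sq_le (hψ : ψ ∈ (trigSpace n)ᗮ) :
    ⟪toL2 bern2, ψ⟫ ^ 2 ≤ 4 * pi * (1 / (n + 1 / 2 : ℝ) ^ 3) * ‖ψ‖ ^ 2 := by
  have hz := hasSum_sub_sum_Icc_le (j := 1) hasSum_zeta_four n
  refine inner_sq_le_of_mem_orthogonal (a := 0) (α := fun k => -(2 / k ^ 2)) (β := 0) hψ ?_ ?_ ?_ hz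
  · rw [inner_bern2_bern2]
    ring
  · rw [inner_trigVec, inner_bern2_one, Finset.mul_sum, zero_mul, zero_add]
    refine Finset.sum_congr rfl fun k hk => ?_
    rw [inner_bern2_cosC (ne_zero_of_mem_Icc hk), Pi.zero_apply]
    ring
  · rw [norm_trigVec_sq, Finset.mul_sum, Finset.mul_sum, zero_pow two_ne_zero, mul_zero, zero_add]
    refine Finset.sum_congr rfl fun k hk => ?_
    rw [Pi.zero_apply]
    ring

theorem inner_bern3_sq_le (hψ : ψ ∈ (trigSpace n)ᗮ) :
    ⟪toL2 bern3, ψ⟫ ^ 2 ≤ 4 * pi * (1 / (n + 1 / 2 : ℝ) ^ 5) * ‖ψ‖ ^ 2 := by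
  have hz := hasSum_sub_sum_Icc_le (j := 2) hasSum_zeta_six n
  refine inner_sq_le_of_mem_orthogonal (a := 0) (α := 0) (β := fun k => -(2 / k ^ 3)) hψ ?_ ?_ ?_ hz
  · rw [inner_bern3_bern3]
    ring
  · rw [inner_trigVec, inner_bern3_one, Finset.mul_sum, zero_mul, zero_add]
    refine Finset.sum_congr rfl fun k hk => ?_
    rw [inner_bern3_sinC (ne_zero_of_mem_Icc hk), Pi.zero_apply]
    ring
  · rw [norm_trigVec_sq, Finset.mul_sum, Finset.mul_sum, zero_pow two_ne_zero, mul_zero, zero_add]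
    refine Finset.sum_congr rfl fun k hk => ?_
    rw [Pi.zero_apply]
    ring

/-! ### Trigonometric polynomials with prescribed low-order structure -/

section Structured

variable {v : L2} {M₀ M₁ M₂ : ℝ}

/-- By Parseval the n frequencies contribute at most Q/π each, where Q is the bracket on the right,
and the constant mode at most Q/(2π): together (n + 1/2) Q/π. -/
theorem norm_sq_le_of_coeff (hv : v = trigVec n (M₀ / (2 * pi))
      (fun k => (M₀ - (k : ℝ) ^ 2 * M₂) / pi) (fun k => -((k : ℝ) * M₁) / pi)) :
    ‖v‖ ^ 2 ≤ (n + 1 / 2) / pi *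
      ((|M₀| + (n + 1 / 2 : ℝ) ^ 2 * |M₂|) ^ 2 + (n + 1 / 2 : ℝ) ^ 2 * M₁ ^ 2) := by
  have hpi := Real.pi_pos
  set h : ℝ := n + 1 / 2 with hh
  have hterm : ∀ k ∈ Finset.Icc 1 n,
      ((M₀ - (k : ℝ) ^ 2 * M₂) / pi) ^ 2 + (-((k : ℝ) * M₁) / pi) ^ 2 ≤
        ((|M₀| + h ^ 2 * |M₂|) ^ 2 + h ^ 2 * M₁ ^ 2) / pi ^ 2 := by
    intro k hk
    have hk : (k : ℝ) ≤ h := by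
      have : (k : ℝ) ≤ n := by exact_mod_cast (Finset.mem_Icc.1 hk).2
      linarith
    have hk2 : (k : ℝ) ^ 2 ≤ h ^ 2 := pow_le_pow_left₀ k.cast_nonneg hk 2
    rw [div_pow, div_pow, ← add_div]
    refine div_le_div_of_nonneg_right (add_le_add ?_ ?_) (by positivity)
    · rw [← sq_abs]
      refine pow_le_pow_left₀ (abs_nonneg _) ((abs_sub _ _).trans ?_) 2
      rw [abs_mul, abs_of_nonneg (by positivity : (0 : ℝ) ≤ (k : ℝ) ^ 2)]
      gcongr
    · rw [neg_sq, mul_pow]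
      gcongr
  have hsum := Finset.sum_le_card_nsmul _ _ _ hterm
  rw [Nat.card_Icc, Nat.add_sub_cancel, nsmul_eq_mul] at hsum
  have hM : M₀ ^ 2 ≤ (|M₀| + h ^ 2 * |M₂|) ^ 2 + h ^ 2 * M₁ ^ 2 := by
    rw [← sq_abs M₀]
    have : |M₀| ^ 2 ≤ (|M₀| + h ^ 2 * |M₂|) ^ 2 :=
      pow_le_pow_left₀ (abs_nonneg _) (by have := abs_nonneg M₂; nlinarith [sq_nonneg h]) 2
    have : 0 ≤ h ^ 2 * M₁ ^ 2 := by positivity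
    linarith
  set Q : ℝ := (|M₀| + h ^ 2 * |M₂|) ^ 2 + h ^ 2 * M₁ ^ 2
  rw [hv, norm_trigVec_sq]
  calc 2 * pi * (M₀ / (2 * pi)) ^ 2 + pi * ∑ k ∈ Finset.Icc 1 n,
        (((M₀ - (k : ℝ) ^ 2 * M₂) / pi) ^ 2 + (-((k : ℝ) * M₁) / pi) ^ 2)
      ≤ M₀ ^ 2 / (2 * pi) + pi * (n * (Q / pi ^ 2)) := by
        refine add_le_add (le_of_eq ?_) (mul_le_mul_of_nonneg_left hsum hpi.le)
        field_simp
    _ ≤ Q / (2 * pi) + pi * (n * (Q / pi ^ 2)) := by gcongr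
    _ = h / pi * Q := by
        rw [hh]
        field_simp
        ring

/-- `bern1` is odd about π and sees only the sines; its weights 2π/k cancel the factor k, leaving n
equal terms. -/
theorem inner_bern1_of_coeff (hv : v = trigVec n (M₀ / (2 * pi))
      (fun k => (M₀ - (k : ℝ) ^ 2 * M₂) / pi) (fun k => -((k : ℝ) * M₁) / pi)) :
    ⟪toL2 bern1, v⟫ = -(2 * n * M₁) := by
  rw [hv, inner_trigVec, inner_bern1_one, mul_zero, zero_add,
    Finset.sum_congr rfl (g := fun _ => -(2 * M₁)), Finset.sum_const, Nat.card_Icc,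
    Nat.add_sub_cancel, nsmul_eq_mul]
  · ring
  · intro k hk
    have hk := ne_zero_of_mem_Icc hk
    have hk' : (k : ℝ) ≠ 0 := Nat.cast_ne_zero.2 hk
    have := Real.pi_ne_zero
    rw [inner_bern1_cosC hk, inner_bern1_sinC hk]
    field_simp
    ring

/-- Only cosines count, with weights proportional to 1/k²: they cancel the k² in front of M₂ and
leave a partial sum of ζ(2) in front of M₀. -/
theorem inner_bern2_of_coeff (hv : v = trigVec n (M₀ / (2 * pi))
      (fun k => (M₀ - (k : ℝ) ^ 2 * M₂) / pi) (fun k => -((k : ℝ) * M₁) / pi)) :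
    ⟪toL2 bern2, v⟫ = 2 * n * M₂ - 2 * (∑ k ∈ Finset.Icc 1 n, 1 / (k : ℝ) ^ 2) * M₀ := by
  rw [hv, inner_trigVec, inner_bern2_one, mul_zero, zero_add,
    Finset.sum_congr rfl (g := fun k : ℕ => 2 * M₂ - 2 * M₀ * (1 / (k : ℝ) ^ 2)),
    Finset.sum_sub_distrib, Finset.sum_const, Nat.card_Icc,
    Nat.add_sub_cancel, nsmul_eq_mul, ← Finset.mul_sum]
  · ring
  · intro k hk
    have hk := ne_zero_of_mem_Icc hk
    have hk' : (k : ℝ) ≠ 0 := Nat.cast_ne_zero.2 hk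
    have := Real.pi_ne_zero
    rw [inner_bern2_cosC hk, inner_bern2_sinC hk]
    field_simp
    ring

theorem inner_bern3_of_coeff (hv : v = trigVec n (M₀ / (2 * pi))
      (fun k => (M₀ - (k : ℝ) ^ 2 * M₂) / pi) (fun k => -((k : ℝ) * M₁) / pi)) :
    ⟪toL2 bern3, v⟫ = 2 * (∑ k ∈ Finset.Icc 1 n, 1 / (k : ℝ) ^ 2) * M₁ := by
  rw [hv, inner_trigVec, inner_bern3_one, mul_zero, zero_add,
    Finset.sum_congr rfl (g := fun k : ℕ => 2 * M₁ * (1 / (k : ℝ) ^ 2)), ← Finset.mul_sum]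
  · ring
  · intro k hk
    have hk := ne_zero_of_mem_Icc hk
    have hk' : (k : ℝ) ≠ 0 := Nat.cast_ne_zero.2 hk
    have := Real.pi_ne_zero
    rw [inner_bern3_cosC hk, inner_bern3_sinC hk]
    field_simp
    ring

end Structured

end TrigonometricPolynomials

/-! ### The adjoint of the integro-differential operator -/

/-- F is the adjoint applied to e: Fubini on the triangle t ≤ x turns integration over t < x into
integration over x > t. -/
theorem inner_toL2_opA (p : ℕ) (e F : C(ℝ, ℝ)) (g : L2)
    (hF : ∀ t, F t = 1 / Real.Gamma p * ∫ x in t..2 * pi, (x - t) ^ (p - 1) * e x) :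
    ⟪toL2 e, opA p g⟫ = ⟪toL2 F, g⟫ := by
  set K : ℝ × ℝ → ℝ := Set.indicator {z : ℝ × ℝ | z.2 ≤ z.1}
    (fun z => 1 / Real.Gamma p * ((z.1 - z.2) ^ (p - 1) * e z.1)) with hK
  have hcont : Continuous fun z : ℝ × ℝ => 1 / Real.Gamma p * ((z.1 - z.2) ^ (p - 1) * e z.1) := by
    fun_prop
  have hset : MeasurableSet {z : ℝ × ℝ | z.2 ≤ z.1} := measurableSet_le measurable_snd measurable_fst
  -- Fubini applies because the kernel is bounded on the compact square and g is integrable.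
  obtain ⟨C, hC⟩ := (isCompact_Icc.prod isCompact_Icc :
    IsCompact (Set.Icc 0 (2 * pi) ×ˢ Set.Icc 0 (2 * pi))).exists_bound_of_continuousOn
      hcont.continuousOn
  have hint : Integrable (Function.uncurry fun x t => K (x, t) * g t) (mu.prod mu) := by
    have h1 : Integrable (fun z : ℝ × ℝ => g z.2) (mu.prod mu) := (integrable_coe g).comp_snd mu
    refine h1.bdd_mul (c := C) (f := K) (hcont.stronglyMeasurable.indicator hset).aestronglyMeasurable ?_
    rw [Measure.prod_restrict]
    refine ae_restrict_of_forall_mem (measurableSet_Ioo.prod measurableSet_Ioo) fun z hz => ?_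
    refine (norm_indicator_le_norm_self _ _).trans (hC z ?_)
    exact ⟨Set.Ioo_subset_Icc_self hz.1, Set.Ioo_subset_Icc_self hz.2⟩
  have hleft : ⟪toL2 e, opA p g⟫ = ∫ x, ∫ t, K (x, t) * g t ∂mu ∂mu := by
    rw [inner_toL2_left]
    refine integral_congr_ae ?_
    filter_upwards [opA_ae_eq p g, ae_restrict_mem measurableSet_Ioo] with x hx hx'
    have h1 : ∀ t, K (x, t) * g t = Set.indicator (Set.Iic x)
        (fun t => e x * (1 / Real.Gamma p * ((x - t) ^ (p - 1) * g t))) t := by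
      intro t
      by_cases h : t ≤ x
      · rw [hK, Set.indicator_of_mem (by exact h), Set.indicator_of_mem (by exact h)]
        ring
      · rw [hK, Set.indicator_of_notMem (by exact h), Set.indicator_of_notMem (by exact h), zero_mul]
    simp only [h1]
    rw [integral_indicator measurableSet_Iic, Measure.restrict_restrict measurableSet_Iic,
      show Set.Iic x ∩ Set.Ioo 0 (2 * pi) = Set.Ioc 0 x by
        ext t
        simp only [Set.mem_inter_iff, Set.mem_Iic, Set.mem_Ioo, Set.mem_Ioc]
        exact ⟨fun h => ⟨h.2.1, h.1⟩, fun h => ⟨h.2, h.1, h.2.trans_lt hx'.2⟩⟩,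
      integral_const_mul, integral_const_mul, hx, volterraFun,
      intervalIntegral.integral_of_le hx'.1.le]
  have hright : ⟪toL2 F, g⟫ = ∫ t, ∫ x, K (x, t) * g t ∂mu ∂mu := by
    rw [inner_toL2_left]
    refine integral_congr_ae ?_
    filter_upwards [ae_restrict_mem measurableSet_Ioo] with t ht
    rw [integral_mul_const, hF]
    congr 1
    have h1 : ∀ x, K (x, t) = Set.indicator (Set.Ici t)
        (fun x => 1 / Real.Gamma p * ((x - t) ^ (p - 1) * e x)) x := by
      intro x
      by_cases h : t ≤ x
      · rw [hK, Set.indicator_of_mem (by exact h), Set.indicator_of_mem (by exact h)]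
      · rw [hK, Set.indicator_of_notMem (by exact h), Set.indicator_of_notMem (by exact h)]
    simp only [h1]
    rw [integral_indicator measurableSet_Ici, Measure.restrict_restrict measurableSet_Ici,
      show Set.Ici t ∩ Set.Ioo 0 (2 * pi) = Set.Ico t (2 * pi) by
        ext x
        simp only [Set.mem_inter_iff, Set.mem_Ici, Set.mem_Ioo, Set.mem_Ico]
        exact ⟨fun h => ⟨h.1, h.2.2⟩, fun h => ⟨h.1, ht.1.trans_le h.1, h.2⟩⟩,
      integral_const_mul, intervalIntegral.integral_of_le ht.2.le, integral_Ico_eq_integral_Ioo,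
      integral_Ioc_eq_integral_Ioo]
  rw [hleft, hright, integral_integral_swap hint]

theorem hasDerivAt_sub_const_pow_two (t x : ℝ) :
    HasDerivAt (fun x => (x - t) ^ 2) (2 * (x - t)) x := by
  exact HasDerivAt.congr_deriv (((hasDerivAt_id x).sub_const t).pow 2) (by simp)

theorem hasDerivAt_two_mul_sub_const (t x : ℝ) :
    HasDerivAt (fun x => 2 * (x - t)) 2 x := by
  simpa using ((hasDerivAt_id x).sub_const t).const_mul 2

section

variable {k : ℕ} (g : L2)

/-- Here 2π - t is written as `bern1` + π. In all these adjoint formulas, polynomials in 2π - t are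
expanded in 1 and the Bernoulli-type polynomials, since the latter have zero mean and simple Fourier
coefficients. -/
theorem inner_one_opA_one : ⟪toL2 1, opA 1 g⟫ = ⟪toL2 (bern1 + pi • 1), g⟫ := by
  refine inner_toL2_opA 1 _ _ g fun t => ?_
  simp
  ring

theorem inner_cosC_opA_one (hk : k ≠ 0) :
    ⟪toL2 (cosC k), opA 1 g⟫ = ⟪toL2 ((-(1 / (k : ℝ))) • sinC k), g⟫ := by
  refine inner_toL2_opA 1 _ _ g fun t => ?_
  have := integral_mul_cos (Nat.cast_ne_zero.2 hk : (k : ℝ) ≠ 0)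
    (fun t => hasDerivAt_const t 1) (fun t => hasDerivAt_const t (0 : ℝ))
    (fun t => hasDerivAt_const t (0 : ℝ)) (fun t => hasDerivAt_const t (0 : ℝ)) t (2 * pi)
  simp [sin_nat_mul_two_pi', Real.cos_nat_mul_two_pi] at this ⊢
  rw [this]

theorem inner_sinC_opA_one (hk : k ≠ 0) :
    ⟪toL2 (sinC k), opA 1 g⟫ = ⟪toL2 ((1 / (k : ℝ)) • (cosC k - 1)), g⟫ := by
  refine inner_toL2_opA 1 _ _ g fun t => ?_
  have := integral_mul_sin (Nat.cast_ne_zero.2 hk : (k : ℝ) ≠ 0)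
    (fun t => hasDerivAt_const t 1) (fun t => hasDerivAt_const t (0 : ℝ))
    (fun t => hasDerivAt_const t (0 : ℝ)) (fun t => hasDerivAt_const t (0 : ℝ)) t (2 * pi)
  simp [sin_nat_mul_two_pi', Real.cos_nat_mul_two_pi] at this ⊢
  rw [this]
  ring

/-- `(2π - t)² / 2` expressed by Bernoulli-type polynomials. -/
theorem inner_one_opA_two :
    ⟪toL2 1, opA 2 g⟫ = ⟪toL2 ((2 * pi ^ 2 / 3) • 1 + pi • bern1 - bern2), g⟫ := by
  refine inner_toL2_opA 2 _ _ g fun t => ?_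
  have h := intervalIntegral.integral_comp_sub_right (a := t) (b := 2 * pi) (fun x => x) t
  simp [h]
  ring

theorem inner_cosC_opA_two (hk : k ≠ 0) :
    ⟪toL2 (cosC k), opA 2 g⟫ = ⟪toL2 ((1 / (k : ℝ) ^ 2) • (1 - cosC k)), g⟫ := by
  refine inner_toL2_opA 2 _ _ g fun t => ?_
  have := integral_mul_cos (Nat.cast_ne_zero.2 hk : (k : ℝ) ≠ 0)
    (fun x => (hasDerivAt_id x).sub_const t) (fun t => hasDerivAt_const t (1 : ℝ))
    (fun t => hasDerivAt_const t (0 : ℝ)) (fun t => hasDerivAt_const t (0 : ℝ)) t (2 * pi)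
  simp [sin_nat_mul_two_pi', Real.cos_nat_mul_two_pi] at this ⊢
  rw [this]
  ring

theorem inner_sinC_opA_two (hk : k ≠ 0) :
    ⟪toL2 (sinC k), opA 2 g⟫ =
      ⟪toL2 (-((1 / (k : ℝ)) • (bern1 + pi • 1)) - (1 / (k : ℝ) ^ 2) • sinC k), g⟫ := by
  refine inner_toL2_opA 2 _ _ g fun t => ?_
  have := integral_mul_sin (Nat.cast_ne_zero.2 hk : (k : ℝ) ≠ 0)
    (fun x => (hasDerivAt_id x).sub_const t) (fun t => hasDerivAt_const t (1 : ℝ))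
    (fun t => hasDerivAt_const t (0 : ℝ)) (fun t => hasDerivAt_const t (0 : ℝ)) t (2 * pi)
  simp [sin_nat_mul_two_pi', Real.cos_nat_mul_two_pi] at this ⊢
  rw [this]
  ring

theorem Gamma_three : Real.Gamma (3 : ℕ) = 2 := by
  rw [show ((3 : ℕ) : ℝ) = (2 : ℕ) + 1 by norm_num, Real.Gamma_nat_eq_factorial]
  rfl

/-- The function on the right is (2π - t)³ / 6. -/
theorem inner_one_opA_three : ⟪toL2 1, opA 3 g⟫ =
    ⟪toL2 ((pi ^ 3 / 3) • 1 + (2 * pi ^ 2 / 3) • bern1 - pi • bern2 + bern3), g⟫ := by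
  refine inner_toL2_opA 3 _ _ g fun t => ?_
  have h := intervalIntegral.integral_comp_sub_right (a := t) (b := 2 * pi) (fun x => x ^ 2) t
  rw [Gamma_three]
  simp [h]
  ring

theorem inner_cosC_opA_three (hk : k ≠ 0) : ⟪toL2 (cosC k), opA 3 g⟫ =
    ⟪toL2 ((1 / (k : ℝ) ^ 2) • (bern1 + pi • 1) + (1 / (k : ℝ) ^ 3) • sinC k), g⟫ := by
  refine inner_toL2_opA 3 _ _ g fun t => ?_
  have := integral_mul_cos (Nat.cast_ne_zero.2 hk : (k : ℝ) ≠ 0)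
    (hasDerivAt_sub_const_pow_two t) (hasDerivAt_two_mul_sub_const t)
    (fun t => hasDerivAt_const t (2 : ℝ)) (fun t => hasDerivAt_const t (0 : ℝ)) t (2 * pi)
  rw [Gamma_three]
  simp [this, sin_nat_mul_two_pi', Real.cos_nat_mul_two_pi]
  ring

theorem inner_sinC_opA_three (hk : k ≠ 0) : ⟪toL2 (sinC k), opA 3 g⟫ =
    ⟪toL2 (-((1 / (k : ℝ)) • ((2 * pi ^ 2 / 3) • 1 + pi • bern1 - bern2))
      + (1 / (k : ℝ) ^ 3) • (1 - cosC k)), g⟫ := by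
  refine inner_toL2_opA 3 _ _ g fun t => ?_
  have := integral_mul_sin (Nat.cast_ne_zero.2 hk : (k : ℝ) ≠ 0)
    (hasDerivAt_sub_const_pow_two t) (hasDerivAt_two_mul_sub_const t)
    (fun t => hasDerivAt_const t (2 : ℝ)) (fun t => hasDerivAt_const t (0 : ℝ)) t (2 * pi)
  rw [Gamma_three]
  simp [this, sin_nat_mul_two_pi', Real.cos_nat_mul_two_pi]
  ring

end

/-! ### The stability estimate -/

section Stability

variable {n : ℕ} {v ψ : L2}

theorem inner_sub_of_mem_orthogonal {e : L2} (he : e ∈ trigSpace n) (hψ : ψ ∈ (trigSpace n)ᗮ) :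
    ⟪e, v - ψ⟫ = ⟪e, v⟫ := by
  rw [inner_sub_right, (Submodule.mem_orthogonal _ _).1 hψ _ he, sub_zero]

/-- The form of `v` dictated by the Galerkin equations. -/
theorem eq_trigVec_of_coeff {M₀ M₁ M₂ : ℝ} (hv : v ∈ trigSpace n) (hψ : ψ ∈ (trigSpace n)ᗮ)
    (h₁ : ⟪toL2 1, v - ψ⟫ = M₀)
    (hc : ∀ k ∈ Finset.Icc 1 n, ⟪toL2 (cosC k), v - ψ⟫ = M₀ - (k : ℝ) ^ 2 * M₂)
    (hs : ∀ k ∈ Finset.Icc 1 n, ⟪toL2 (sinC k), v - ψ⟫ = -((k : ℝ) * M₁)) :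
    v = trigVec n (M₀ / (2 * pi))
      (fun k => (M₀ - (k : ℝ) ^ 2 * M₂) / pi) (fun k => -((k : ℝ) * M₁) / pi) := by
  have hpi := Real.pi_ne_zero
  refine eq_trigVec hv ?_ (fun k hk => ?_) fun k hk => ?_
  · rw [← inner_sub_of_mem_orthogonal toL2_one_mem hψ, h₁]
    field_simp
  · rw [← inner_sub_of_mem_orthogonal (toL2_cosC_mem hk) hψ, hc k hk]
    field_simp
  · rw [← inner_sub_of_mem_orthogonal (toL2_sinC_mem hk) hψ, hs k hk]
    field_simp

/-- The factor n + 1/2 in `norm_sq_le_of_coeff` cancels against e², so bounds on the scaled unknowns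
M₀, hM₁, h²M₂ in units of e give a bound on v free of n. -/
theorem norm_le_of_scaled {M₀ M₁ M₂ X e : ℝ} (hX : 0 ≤ X)
    (hv : v = trigVec n (M₀ / (2 * pi))
      (fun k => (M₀ - (k : ℝ) ^ 2 * M₂) / pi) (fun k => -((k : ℝ) * M₁) / pi))
    (he : (n + 1 / 2) * e ^ 2 = 4 * pi * ‖ψ‖ ^ 2)
    (h : (|M₀| + |(n + 1 / 2 : ℝ) ^ 2 * M₂|) ^ 2 + ((n + 1 / 2 : ℝ) * M₁) ^ 2 ≤ (X * e) ^ 2) :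
    ‖v‖ ≤ 2 * X * ‖ψ‖ := by
  have hpi := Real.pi_pos
  refine le_of_sq_le_sq ((norm_sq_le_of_coeff hv).trans ?_) (by positivity)
  rw [abs_mul, abs_of_nonneg (by positivity : (0 : ℝ) ≤ (n + 1 / 2 : ℝ) ^ 2), mul_pow _ M₁] at h
  calc _ ≤ (n + 1 / 2) / pi * (X * e) ^ 2 := by gcongr
    _ = (n + 1 / 2) * e ^ 2 * X ^ 2 / pi := by ring
    _ = (2 * X * ‖ψ‖) ^ 2 := by
      rw [he]
      field_simp
      ring

/-- The scale `e` of the residuals, with `(n + 1/2) e² = 4π ‖ψ‖²`. -/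
theorem exists_scale (hψ : ψ ∈ (trigSpace n)ᗮ) : ∃ e : ℝ, 0 ≤ e ∧
    (n + 1 / 2) * e ^ 2 = 4 * pi * ‖ψ‖ ^ 2 ∧ |⟪toL2 bern1, ψ⟫| ≤ e ∧
    |(n + 1 / 2) * ⟪toL2 bern2, ψ⟫| ≤ e ∧ |(n + 1 / 2 : ℝ) ^ 2 * ⟪toL2 bern3, ψ⟫| ≤ e := by
  have hpi := Real.pi_pos
  set h : ℝ := n + 1 / 2 with hh
  have hpos : 0 < h := by positivity
  have hsq : Real.sqrt (4 * pi / h * ‖ψ‖ ^ 2) ^ 2 = 4 * pi / h * ‖ψ‖ ^ 2 :=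
    Real.sq_sqrt (by positivity)
  refine ⟨Real.sqrt (4 * pi / h * ‖ψ‖ ^ 2), Real.sqrt_nonneg _, ?_, ?_, ?_, ?_⟩
  · rw [hsq]
    field_simp
  · refine abs_le_of_sq_le_sq ?_ (Real.sqrt_nonneg _)
    rw [hsq]
    refine (inner_bern1_sq_le hψ).trans (le_of_eq ?_)
    rw [← hh]
    field_simp
  · refine abs_le_of_sq_le_sq ?_ (Real.sqrt_nonneg _)
    rw [hsq, mul_pow]
    refine (mul_le_mul_of_nonneg_left (inner_bern2_sq_le hψ) (sq_nonneg _)).trans (le_of_eq ?_)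
    rw [← hh]
    field_simp
  · refine abs_le_of_sq_le_sq ?_ (Real.sqrt_nonneg _)
    rw [hsq, mul_pow]
    refine (mul_le_mul_of_nonneg_left (inner_bern3_sq_le hψ) (sq_nonneg _)).trans (le_of_eq ?_)
    rw [← hh]
    field_simp

/-- The scaled zeta tail `(n + 1/2) ∑_{k > n} 2 / k²` lies in `[0, 2]`. -/
theorem scaled_tail_mem (n : ℕ) :
    0 ≤ (n + 1 / 2) * (pi ^ 2 / 3 - 2 * ∑ k ∈ Finset.Icc 1 n, 1 / (k : ℝ) ^ 2) ∧
      (n + 1 / 2) * (pi ^ 2 / 3 - 2 * ∑ k ∈ Finset.Icc 1 n, 1 / (k : ℝ) ^ 2) ≤ 2 := by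
  have h1 := sum_Icc_le_of_hasSum hasSum_zeta_two n
  have h2 := hasSum_sub_sum_Icc_le (j := 0) hasSum_zeta_two n
  rw [mul_zero, zero_add, pow_one, mul_one, le_div_iff₀ (by positivity)] at h2
  constructor
  · refine mul_nonneg (by positivity) ?_
    linarith
  · linarith

/-- One step of elimination: D is the pivot and q bounds the ratio of the coefficient sum to it.
Shorter combinations take c = 0. -/
theorem abs_le_of_mul_eq {x D a b c ε₁ ε₂ ε₃ e q : ℝ} (hD : 0 < D)
    (h : x * D = a * ε₁ + b * ε₂ + c * ε₃) (h₁ : |ε₁| ≤ e) (h₂ : |ε₂| ≤ e) (h₃ : |ε₃| ≤ e)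
    (hq : |a| + |b| + |c| ≤ q * D) : |x| ≤ q * e := by
  have he : 0 ≤ e := (abs_nonneg _).trans h₁
  have h4 : |x| * D ≤ (|a| + |b| + |c|) * e := by
    nth_rw 1 [← abs_of_pos hD]
    rw [← abs_mul, h]
    refine (abs_add_three _ _ _).trans ?_
    rw [abs_mul, abs_mul, abs_mul, add_mul, add_mul]
    gcongr
  refine le_of_mul_le_mul_right (h4.trans ?_) hD
  calc (|a| + |b| + |c|) * e ≤ q * D * e := by gcongr
    _ = q * e * D := by ring

/-- Here v is M₀/π times the Dirichlet kernel 1/2 + ∑ cos kt, so it is orthogonal to `bern1`, and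
testing with 1 leaves πM₀ = ⟨bern1, ψ⟩. -/
theorem norm_le_of_opA_one (hv : v ∈ trigSpace n) (hψ : ψ ∈ (trigSpace n)ᗮ)
    (hA : opA 1 (v - ψ) ∈ (trigSpace n)ᗮ) : ‖v‖ ≤ 2 / pi * ‖ψ‖ := by
  have hpi := Real.pi_pos
  have h1 := (Submodule.mem_orthogonal _ _).1 hA _ toL2_one_mem
  have hc := fun k hk => (Submodule.mem_orthogonal _ _).1 hA _ (toL2_cosC_mem (k := k) hk)
  have hs := fun k hk => (Submodule.mem_orthogonal _ _).1 hA _ (toL2_sinC_mem (k := k) hk)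
  rw [inner_one_opA_one, map_add, map_smul, inner_add_left, real_inner_smul_left] at h1
  set M₀ := ⟪toL2 1, v - ψ⟫ with hM₀
  -- The adjoint swaps the two families: sine equations give the cosine coefficients, and
  -- conversely.
  have hv' := eq_trigVec_of_coeff (M₀ := M₀) (M₁ := 0) (M₂ := 0) hv hψ rfl
    (fun k hk => by
      have h := hs k hk
      have hk' : (k : ℝ) ≠ 0 := Nat.cast_ne_zero.2 (ne_zero_of_mem_Icc hk)
      rw [inner_sinC_opA_one _ (ne_zero_of_mem_Icc hk), map_smul, map_sub, real_inner_smul_left,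
        inner_sub_left, ← hM₀] at h
      field_simp at h
      linarith)
    (fun k hk => by
      have h := hc k hk
      have hk' : (k : ℝ) ≠ 0 := Nat.cast_ne_zero.2 (ne_zero_of_mem_Icc hk)
      rw [inner_cosC_opA_one _ (ne_zero_of_mem_Icc hk), map_smul, real_inner_smul_left] at h
      field_simp at h
      linarith)
  rw [inner_sub_right, inner_bern1_of_coeff hv'] at h1
  obtain ⟨e, he0, he, he1, -, -⟩ := exists_scale hψ
  have hM : M₀ = ⟪toL2 bern1, ψ⟫ / pi := by
    field_simp
    linarith
  rw [show 2 / pi = 2 * (1 / pi) by ring]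
  refine norm_le_of_scaled (by positivity) hv' he ?_
  rw [mul_zero, mul_zero, abs_zero, zero_pow two_ne_zero, add_zero, add_zero, hM, abs_div,
    abs_of_pos hpi, one_div_mul_eq_div]
  gcongr

/-- The definition of M₁ and the vanishing of M₂ form a 2 × 2 system for M₀ and hM₁, with pivot π² -
2T ≥ π² - 4. -/
theorem norm_le_of_opA_two (hv : v ∈ trigSpace n) (hψ : ψ ∈ (trigSpace n)ᗮ)
    (hA : opA 2 (v - ψ) ∈ (trigSpace n)ᗮ) : ‖v‖ ≤ 2.8 * ‖ψ‖ := by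
  have h1 := (Submodule.mem_orthogonal _ _).1 hA _ toL2_one_mem
  have hc := fun k hk => (Submodule.mem_orthogonal _ _).1 hA _ (toL2_cosC_mem (k := k) hk)
  have hs := fun k hk => (Submodule.mem_orthogonal _ _).1 hA _ (toL2_sinC_mem (k := k) hk)
  rw [inner_one_opA_two] at h1
  simp only [map_add, map_sub, map_smul, inner_add_left, inner_sub_left,
    real_inner_smul_left] at h1
  set M₀ := ⟪toL2 1, v - ψ⟫ with hM₀
  set M₁ := ⟪toL2 bern1, v - ψ⟫ + pi * M₀ with hM₁
  have hv' := eq_trigVec_of_coeff (M₀ := M₀) (M₁ := M₁) (M₂ := 0) hv hψ rfl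
    (fun k hk => by
      have h := hc k hk
      have hk' : (k : ℝ) ≠ 0 := Nat.cast_ne_zero.2 (ne_zero_of_mem_Icc hk)
      rw [inner_cosC_opA_two _ (ne_zero_of_mem_Icc hk), map_smul, map_sub, real_inner_smul_left,
        inner_sub_left, ← hM₀] at h
      field_simp at h
      linarith)
    (fun k hk => by
      have h := hs k hk
      have hk' : (k : ℝ) ≠ 0 := Nat.cast_ne_zero.2 (ne_zero_of_mem_Icc hk)
      rw [inner_sinC_opA_two _ (ne_zero_of_mem_Icc hk)] at h
      simp only [map_sub, map_neg, map_smul,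
        map_add, inner_sub_left, inner_neg_left, real_inner_smul_left, inner_add_left, ← hM₀,
        ← hM₁] at h
      field_simp at h
      linarith)
  have hB1 := inner_bern1_of_coeff hv'
  have hB2 := inner_bern2_of_coeff hv'
  have hE1 := inner_sub_right (𝕜 := ℝ) (toL2 bern1) v ψ
  have hE2 := inner_sub_right (𝕜 := ℝ) (toL2 bern2) v ψ
  obtain ⟨e, he0, he, he1, he2, -⟩ := exists_scale hψ
  obtain ⟨hT0, hT2⟩ := scaled_tail_mem n
  -- 1.4 suffices because 0.9² + 0.96² ≤ 1.4², with the bounds `b0` and `b1` below.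
  rw [show (2.8 : ℝ) = 2 * 1.4 by norm_num]
  refine norm_le_of_scaled (by norm_num) hv' he ?_
  rw [mul_zero, abs_zero, add_zero, sq_abs]
  set s := ∑ k ∈ Finset.Icc 1 n, 1 / (k : ℝ) ^ 2
  set h : ℝ := n + 1 / 2 with hh
  have hn : (n : ℝ) = h - 1 / 2 := by rw [hh]; ring
  set T := h * (pi ^ 2 / 3 - 2 * s) with hT
  set ε₁ := ⟪toL2 bern1, ψ⟫
  set ε₂ := h * ⟪toL2 bern2, ψ⟫ with hε₂
  rw [hn] at hB1
  rw [hB1] at hE1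
  rw [hB2] at hE2
  clear_value M₀ M₁ s h T ε₁ ε₂
  -- Since -2nM₁ = M₁ - 2hM₁, the choice h = n + 1/2 absorbs the M₁ coming from its own definition.
  have r1 : 2 * (h * M₁) = pi * M₀ - ε₁ := by linear_combination hM₁ + hE1
  have r2 : pi * (h * M₁) = T * M₀ - ε₂ := by
    have h2 : pi * M₁ = (pi ^ 2 / 3 - 2 * s) * M₀ - ⟪toL2 bern2, ψ⟫ := by
      linear_combination pi * hM₁ + h1 + hE2
    rw [hT, hε₂]
    linear_combination h * h2
  have r3 : M₀ * (pi ^ 2 - 2 * T) = pi * ε₁ - 2 * ε₂ := by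
    linear_combination 2 * r2 - pi * r1
  have hπ := Real.pi_gt_d4
  have hπ' := Real.pi_lt_d4
  have hπ2 : 9.869 < pi ^ 2 := by nlinarith
  have he2' := sq_nonneg e
  -- The worst case is T = 2, where (π + 2)/(π² - 4) ≈ 0.88.
  have b0 : |M₀| ≤ 0.9 * e := by
    refine abs_le_of_mul_eq (D := pi ^ 2 - 2 * T) (a := pi) (b := -2) (c := 0) (ε₃ := 0)
      (by linarith) (by linear_combination r3) he1 he2 (by simpa using he0) ?_
    rw [abs_of_pos Real.pi_pos]
    norm_num
    linarith
  -- Back-substitution with |M₀| ≤ e: (T + 1)/π ≤ 3/π < 0.96.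
  have b1 : |h * M₁| ≤ 0.96 * e := by
    refine abs_le_of_mul_eq (D := pi) (a := T) (b := -1) (c := 0) (ε₃ := 0)
      Real.pi_pos (by linear_combination r2) (b0.trans (by linarith)) he2 (by simpa using he0) ?_
    rw [abs_of_nonneg hT0]
    norm_num
    linarith
  rw [← sq_abs M₀, ← sq_abs (h * M₁)]
  linarith [pow_le_pow_left₀ (abs_nonneg _) b0 2, pow_le_pow_left₀ (abs_nonneg _) b1 2]

/-- The definitions of M₁ and M₂ and the vanishing of the third moment give a 3 × 3 system for M₀,
hM₁, h²M₂. Eliminating the outer two leaves the pivot π² - 4T ≥ π² - 8 for hM₁, the tightest of the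
three cases. -/
theorem norm_le_of_opA_three (hv : v ∈ trigSpace n) (hψ : ψ ∈ (trigSpace n)ᗮ)
    (hA : opA 3 (v - ψ) ∈ (trigSpace n)ᗮ) : ‖v‖ ≤ 17 * ‖ψ‖ := by
  have h1 := (Submodule.mem_orthogonal _ _).1 hA _ toL2_one_mem
  have hc := fun k hk => (Submodule.mem_orthogonal _ _).1 hA _ (toL2_cosC_mem (k := k) hk)
  have hs := fun k hk => (Submodule.mem_orthogonal _ _).1 hA _ (toL2_sinC_mem (k := k) hk)
  rw [inner_one_opA_three] at h1
  simp only [map_add, map_sub, map_smul, inner_add_left, inner_sub_left,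
    real_inner_smul_left] at h1
  set M₀ := ⟪toL2 1, v - ψ⟫ with hM₀
  set M₁ := ⟪toL2 bern1, v - ψ⟫ + pi * M₀ with hM₁
  set M₂ := 2 * pi ^ 2 / 3 * M₀ + pi * ⟪toL2 bern1, v - ψ⟫ - ⟪toL2 bern2, v - ψ⟫ with hM₂
  have hv' := eq_trigVec_of_coeff (M₀ := M₀) (M₁ := M₁) (M₂ := M₂) hv hψ rfl
    (fun k hk => by
      have h := hs k hk
      have hk' : (k : ℝ) ≠ 0 := Nat.cast_ne_zero.2 (ne_zero_of_mem_Icc hk)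
      rw [inner_sinC_opA_three _ (ne_zero_of_mem_Icc hk)] at h
      simp only [map_sub, map_neg, map_smul,
        map_add, inner_sub_left, inner_neg_left, real_inner_smul_left, inner_add_left, ← hM₀,
        ← hM₂] at h
      field_simp at h
      linarith)
    (fun k hk => by
      have h := hc k hk
      have hk' : (k : ℝ) ≠ 0 := Nat.cast_ne_zero.2 (ne_zero_of_mem_Icc hk)
      simp only [inner_cosC_opA_three _ (ne_zero_of_mem_Icc hk), map_smul,
        map_add, real_inner_smul_left, inner_add_left, ← hM₀, ← hM₁] at h
      field_simp at h
      linarith)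
  have hB1 := inner_bern1_of_coeff hv'
  have hB2 := inner_bern2_of_coeff hv'
  have hB3 := inner_bern3_of_coeff hv'
  have hE1 := inner_sub_right (𝕜 := ℝ) (toL2 bern1) v ψ
  have hE2 := inner_sub_right (𝕜 := ℝ) (toL2 bern2) v ψ
  have hE3 := inner_sub_right (𝕜 := ℝ) (toL2 bern3) v ψ
  obtain ⟨e, he0, he, he1, he2, he3⟩ := exists_scale hψ
  obtain ⟨hT0, hT2⟩ := scaled_tail_mem n
  rw [show (17 : ℝ) = 2 * 8.5 by norm_num]
  refine norm_le_of_scaled (by norm_num) hv' he ?_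
  set s := ∑ k ∈ Finset.Icc 1 n, 1 / (k : ℝ) ^ 2
  set h : ℝ := n + 1 / 2 with hh
  have hn : (n : ℝ) = h - 1 / 2 := by rw [hh]; ring
  set T := h * (pi ^ 2 / 3 - 2 * s) with hT
  set ε₁ := ⟪toL2 bern1, ψ⟫
  set ε₂ := h * ⟪toL2 bern2, ψ⟫ with hε₂
  set ε₃ := h ^ 2 * ⟪toL2 bern3, ψ⟫ with hε₃
  rw [hn] at hB1 hB2
  rw [hB1] at hE1
  rw [hB2] at hE2
  rw [hB3] at hE3
  clear_value M₀ M₁ M₂ s h T ε₁ ε₂ ε₃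
  have r1 : pi * M₀ = 2 * (h * M₁) + ε₁ := by linear_combination -hM₁ - hE1
  have r2 : 2 * (h ^ 2 * M₂) - pi * (h * M₁) + T * M₀ = ε₂ := by
    rw [hT, hε₂]
    linear_combination h * hM₂ - h * pi * hM₁ - h * hE2
  -- This is the vanishing third moment, with `bern1` and `bern2` eliminated through M₁ and M₂.
  have r3 : pi * (h ^ 2 * M₂) = ε₃ + T * (h * M₁) := by
    rw [hT, hε₃]
    linear_combination h ^ 2 * (h1 - hE3 + pi * hM₂ - pi ^ 2 / 3 * hM₁)
  have r4 : h * M₁ * (4 * T - pi ^ 2) = pi * ε₂ - T * ε₁ - 2 * ε₃ := by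
    linear_combination pi * r2 - T * r1 - 2 * r3
  have hπ := Real.pi_gt_d4
  have hπ' := Real.pi_lt_d4
  have hπ2 : 9.869 < pi ^ 2 := by nlinarith
  have he2' := sq_nonneg e
  -- The worst case is again T = 2, where (4 + π)/(π² - 8) ≈ 3.82.
  have b1 : |h * M₁| ≤ 3.9 * e := by
    refine abs_le_of_mul_eq (D := pi ^ 2 - 4 * T) (a := T) (b := -pi) (c := 2)
      (by linarith) (by linear_combination -r4) he1 he2 he3 ?_
    rw [abs_of_nonneg hT0, abs_neg, abs_of_pos Real.pi_pos, abs_two]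
    linarith
  -- Here 3.9 e serves as the common bound for hM₁ and ε₁, and 3/π < 0.96.
  have b0 : |M₀| ≤ 0.96 * (3.9 * e) := by
    refine abs_le_of_mul_eq (D := pi) (a := 2) (b := 1) (c := 0) (ε₃ := 0) Real.pi_pos
      (by linear_combination r1) b1 (he1.trans (by linarith)) (by simp; positivity) ?_
    norm_num
    linarith
  have b2 : |h ^ 2 * M₂| ≤ 0.96 * (3.9 * e) := by
    refine abs_le_of_mul_eq (D := pi) (a := T) (b := 1) (c := 0) (ε₃ := 0) Real.pi_pos
      (by linear_combination r3) b1 (he3.trans (by linarith)) (by simp; positivity) ?_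
    rw [abs_of_nonneg hT0]
    norm_num
    linarith
  rw [← sq_abs (h * M₁)]
  -- 2 · 0.96 · 3.9 < 7.5, and 7.5² + 3.9² ≤ 8.5².
  have b3 : |M₀| + |h ^ 2 * M₂| ≤ 7.5 * e := by linarith
  linarith [pow_le_pow_left₀ (by positivity) b3 2, pow_le_pow_left₀ (abs_nonneg _) b1 2]

end Stability

/-! ### The Groetsch regularizer -/

/-- Stability makes A_n bijective, so the least-squares problem is solved exactly and R_n φ differs
from P_n φ by a v to which the same stability bound applies. -/
theorem norm_groetschR_apply_le {p n : ℕ} {c : ℝ} (hc0 : 0 ≤ c)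
    (hc : ∀ v ψ : L2, v ∈ trigSpace n → ψ ∈ (trigSpace n)ᗮ → opA p (v - ψ) ∈ (trigSpace n)ᗮ →
      ‖v‖ ≤ c * ‖ψ‖) (φ : L2) : ‖groetschR p n φ‖ ≤ (1 + c) * ‖φ‖ := by
  have hproj : ∀ v : trigSpace n, projP n (v : L2) = v :=
    fun v => Submodule.orthogonalProjectionOnto_mem_subspace_eq_self v
  have hT : ∀ v : trigSpace n, galerkinOp p n v = projP n (opA p v) := fun v => by
    change projP n (opA p (projP n (v : L2))) = _
    rw [hproj]
  have hinj : Function.Injective (galerkinOp p n).toLinearMap := by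
    refine LinearMap.ker_eq_bot.1 (LinearMap.ker_eq_bot'.2 fun v hv => ?_)
    -- Stability with ψ = 0 forces an element of the kernel to vanish.
    have h0 : opA p ((v : L2) - 0) ∈ (trigSpace n)ᗮ := by
      rw [sub_zero]
      exact Submodule.orthogonalProjectionOnto_eq_zero_iff.1 ((hT v).symm.trans hv)
    have h1 := hc v 0 v.2 (zero_mem _) h0
    rw [norm_zero, mul_zero] at h1
    exact Subtype.ext (norm_le_zero_iff.1 h1)
  have hrange : LinearMap.range (galerkinOp p n).toLinearMap = ⊤ :=
    LinearMap.range_eq_top.2 (LinearMap.injective_iff_surjective.1 hinj)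
  set u : trigSpace n := moorePenrose (galerkinOp p n) (projP n (opA p φ)) with hu
  have hTu : projP n (opA p u) = projP n (opA p φ) := by
    have h := ((isMinNormLeastSquares_iff _ _ _).1
      (moorePenrose_spec (galerkinOp p n) (projP n (opA p φ)))).1
    rw [← hT, h]
    refine Submodule.starProjection_eq_self_iff.2 ?_
    rw [hrange]
    exact Submodule.mem_top
  set v : L2 := u - projP n φ with hv
  set ψ : L2 := φ - projP n φ with hψ
  have hvψ : opA p (v - ψ) ∈ (trigSpace n)ᗮ := by
    rw [hv, hψ, sub_sub_sub_cancel_right, map_sub]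
    refine Submodule.orthogonalProjectionOnto_eq_zero_iff.1 ?_
    rw [map_sub]
    exact sub_eq_zero.2 hTu
  have hψmem : ψ ∈ (trigSpace n)ᗮ := Submodule.sub_starProjection_mem_orthogonal φ
  have h1 := hc v ψ (sub_mem u.2 (projP n φ).2) hψmem hvψ
  have hsq : ‖φ‖ ^ 2 = ‖(projP n φ : L2)‖ ^ 2 + ‖ψ‖ ^ 2 := by
    have h2 := norm_add_sq_real (projP n φ : L2) ψ
    rw [(Submodule.mem_orthogonal _ _).1 hψmem _ (projP n φ).2, hψ, add_sub_cancel] at h2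
    linarith
  have hP : ‖(projP n φ : L2)‖ ≤ ‖φ‖ :=
    le_of_sq_le_sq (by nlinarith [sq_nonneg ‖ψ‖]) (norm_nonneg _)
  have hψle : ‖ψ‖ ≤ ‖φ‖ :=
    le_of_sq_le_sq (by nlinarith [sq_nonneg ‖(projP n φ : L2)‖]) (norm_nonneg _)
  change ‖(u : L2)‖ ≤ _
  calc ‖(u : L2)‖ = ‖(projP n φ : L2) + v‖ := by rw [hv, add_sub_cancel]
    _ ≤ ‖(projP n φ : L2)‖ + ‖v‖ := norm_add_le _ _
    _ ≤ ‖φ‖ + c * ‖φ‖ := add_le_add hP (h1.trans (mul_le_mul_of_nonneg_left hψle hc0))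
    _ = (1 + c) * ‖φ‖ := by ring

/-! ### Numerical values of the constants -/

theorem kappa_one : kappa 1 = Real.sqrt (6 / pi ^ 2) := by
  rw [kappa]
  congr 1
  simp [decayConst, Fin.sum_univ_succ, div_pow]
  ring

theorem kappa_two : kappa 2 = Real.sqrt (44.5 + pi ^ 2) := by
  rw [kappa]
  congr 1
  simp [decayConst, Fin.sum_univ_succ, div_pow, mul_pow]
  ring

theorem kappa_three : kappa 3 = Real.sqrt (4405 + 2 / 9 + 121 * pi ^ 2) := by
  rw [kappa]
  congr 1
  simp [decayConst, Fin.sum_univ_succ, div_pow, mul_pow]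
  ring

theorem abs_kappa_one_sub_lt : |kappa 1 - 0.78| < 0.01 := by
  have h1 := Real.pi_gt_d4
  have h2 := Real.pi_lt_d4
  have hpi := Real.pi_pos
  rw [kappa_one, abs_sub_lt_iff, sub_lt_iff_lt_add, sub_lt_comm,
    Real.sqrt_lt' (by norm_num), div_lt_iff₀ (by positivity)]
  refine ⟨by nlinarith, Real.lt_sqrt_of_sq_lt ?_⟩
  rw [lt_div_iff₀ (by positivity)]
  nlinarith

theorem abs_kappa_two_sub_lt : |kappa 2 - 7.37| < 0.01 := by
  have h1 := Real.pi_gt_d4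
  have h2 := Real.pi_lt_d4
  rw [kappa_two, abs_sub_lt_iff, sub_lt_iff_lt_add, sub_lt_comm, Real.sqrt_lt' (by norm_num)]
  refine ⟨by nlinarith, Real.lt_sqrt_of_sq_lt ?_⟩
  nlinarith

theorem abs_kappa_three_sub_lt : |kappa 3 - 74.82| < 0.01 := by
  have h1 := Real.pi_gt_d4
  have h2 := Real.pi_lt_d4
  rw [kappa_three, abs_sub_lt_iff, sub_lt_iff_lt_add, sub_lt_comm, Real.sqrt_lt' (by norm_num)]
  refine ⟨by nlinarith, Real.lt_sqrt_of_sq_lt ?_⟩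
  nlinarith

theorem norm_groetschR_le {p : ℕ} (hp : p ∈ ({1, 2, 3} : Set ℕ)) (n : ℕ) :
    ‖groetschR p n‖ ≤ gammaConst p := by
  have hk : 0 ≤ kappa p := Real.sqrt_nonneg _
  refine ContinuousLinearMap.opNorm_le_bound _ (add_nonneg zero_le_one hk)
    (norm_groetschR_apply_le hk fun v ψ hv hψ hA => ?_)
  rcases hp with rfl | rfl | rfl
  · refine (norm_le_of_opA_one hv hψ hA).trans (mul_le_mul_of_nonneg_right ?_ (norm_nonneg _))
    rw [kappa_one]
    refine Real.le_sqrt_of_sq_le ?_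
    -- The comparison of squares comes down to 2² ≤ 6.
    rw [div_pow]
    gcongr
    norm_num
  · refine (norm_le_of_opA_two hv hψ hA).trans (mul_le_mul_of_nonneg_right ?_ (norm_nonneg _))
    have := (abs_lt.1 abs_kappa_two_sub_lt).1
    linarith
  · refine (norm_le_of_opA_three hv hψ hA).trans (mul_le_mul_of_nonneg_right ?_ (norm_nonneg _))
    have := (abs_lt.1 abs_kappa_three_sub_lt).1
    linarith

end TrigGalerkin

end


theorem theorem5p1 :
    (∀ p ∈ ({1, 2, 3} : Set ℕ),
      BddAbove (Set.range fun n : ℕ => ‖TrigGalerkin.groetschR p n‖) ∧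
      (⨆ n : ℕ, ‖TrigGalerkin.groetschR p n‖) ≤ TrigGalerkin.gammaConst p) ∧
    |TrigGalerkin.kappa 1 - 0.78| < 0.01 ∧
    |TrigGalerkin.kappa 2 - 7.37| < 0.01 ∧
    |TrigGalerkin.kappa 3 - 74.82| < 0.01 := by
  refine ⟨fun p hp => ⟨⟨TrigGalerkin.gammaConst p, ?_⟩,
    ciSup_le (TrigGalerkin.norm_groetschR_le hp)⟩, TrigGalerkin.abs_kappa_one_sub_lt,
    TrigGalerkin.abs_kappa_two_sub_lt, TrigGalerkin.abs_kappa_three_sub_lt⟩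
  rintro _ ⟨n, rfl⟩
  exact TrigGalerkin.norm_groetschR_le hp n
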